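/- Let $|a|<1$, $\sigma_\xi^2\ge 0$, let $\{\xi(k)\}_{k\ge1}$ be i.i.d. $N(0,\sigma_\xi^2)$ random variables, let $x(1)\sim N(0,\sigma_x^2)$ with $\sigma_x^2=\sigma_\xi^2/(1-a^2)$ be independent of $\{\xi(k)\}_{k\ge 1}$, and let $x(k+1)=a\,x(k)+\xi(k)$ for $k=1,2,\dots$ (a stationary first-order Gauss–Markov source). A real process $\{y(k)\}_{k\ge1}$, jointly distributed with $\{x(k)\}_{k\ge 1}$, is called *causally related to the source* if for every $k\ge1$ the Markov chain $x_{k+1}^\infty\to x_1^k\to y_1^k$ holds (that is, $x_{k+1}^\infty$ and $y_1^k$ are conditionally independent given $x_1^k$). The *information-theoretic causal rate-distortion function* of the source (in nats per sample) under the average MSE constraint is $$R_c^{it}(D)=\inf\Big\{\limsup_{n\to\infty}\tfrac1n I(x_1^n;y_1^n)\;:\; y \text{ causally related to } x,\ \limsup_{n\to\infty}\tfrac1n E\|x_1^n-y_1^n\|^2\le D\Big\},$$ where $I$ is mutual information. The *sequential rate-distortion function* with horizon $n$ and per-sample MSE constraint is $$R_{SRD,n}^{it}(D)=\inf\Big\{\tfrac1n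 I(x_1^n;y_1^n)\;:\; y \text{ causally related to } x,\ E[(y(k)-x(k))^2]\le D\ \text{ for } k=1,\dots,n\Big\}.$$ Then for every $D>0$ $$R_c^{it}(D)=\max\Big\{0,\ \tfrac12\ln\Big(a^2+\frac{\sigma_\xi^2}{D}\Big)\Big\}$$ (with $\ln 0=-\infty$); in particular, for $0<D\le\sigma_x^2$, $$R_c^{it}(D)=\tfrac12\ln\Big(a^2+\frac{\sigma_\xi^2}{D}\Big).$$ Moreover this coincides with the sequential rate-distortion function under the per-sample constraint: for every $D>0$, $\lim_{n\to\infty}R_{SRD,n}^{it}(D)=\max\{0,\tfrac12\ln(a^2+\sigma_\xi^2/D)\}$. -/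

import Mathlib

open MeasureTheory ProbabilityTheory Filter Topology InformationTheory
open scoped ENNReal NNReal

noncomputable section

/-- One-sided real sequences. Index `k : ℕ` stands for the time instant `k + 1`. -/
abbrev RSeq : Type := ℕ → ℝ

/-- Sample space of a pair (source sequence, reconstruction sequence). -/
abbrev RSeqPair : Type := RSeq × RSeq

/-- The first `n` samples `s_1, …, s_n` of a sequence. -/
def firstSamples (n : ℕ) (s : RSeq) : Fin n → ℝ := fun i => s i

/-- The samples of a sequence up to and including index `k`. -/
def pastSamples (k : ℕ) (s : RSeq) : Set.Iic k → ℝ := fun i => s i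

/-- The samples of a sequence strictly after index `k`. -/
def futureSamples (k : ℕ) (s : RSeq) : Set.Ioi k → ℝ := fun i => s i

theorem measurable_pastSamples (k : ℕ) : Measurable (pastSamples k) :=
  measurable_pi_lambda _ fun i => measurable_pi_apply (i : ℕ)

/-- Mutual information `I(U; V)` in nats: the Kullback–Leibler divergence of the joint law from the
product of the marginal laws. -/
def mutualInfo {Ω α β : Type*} [MeasurableSpace Ω] [MeasurableSpace α] [MeasurableSpace β]
    (P : Measure Ω) (U : Ω → α) (V : Ω → β) : ℝ≥0∞ :=
  klDiv (P.map fun ω => (U ω, V ω)) ((P.map U).prod (P.map V))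

/-- `(1/n) I(x_1^n; y_1^n)` when the pair `(x, y)` has law `π`. -/
def blockInfoRate (π : Measure RSeqPair) (n : ℕ) : ℝ≥0∞ :=
  mutualInfo π (fun z => firstSamples n z.1) (fun z => firstSamples n z.2) / n

/-- Mutual information rate `limsup_n (1/n) I(x_1^n; y_1^n)`. -/
def mutualInfoRate (π : Measure RSeqPair) : ℝ≥0∞ :=
  limsup (blockInfoRate π) atTop

/-- Mean squared error `E[(y_k - x_k)²]` of the sample with index `k`. -/
def sampleMSE (π : Measure RSeqPair) (k : ℕ) : ℝ≥0∞ :=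
  ∫⁻ z, ENNReal.ofReal ((z.2 k - z.1 k) ^ 2) ∂π

/-- Average distortion `limsup_n (1/n) E[‖x_1^n - y_1^n‖²]`. -/
def avgMSE (π : Measure RSeqPair) : ℝ≥0∞ :=
  limsup (fun n : ℕ => (∑ k ∈ Finset.range n, sampleMSE π k) / n) atTop

/-- Causality: for every `k`, the Markov chain (source after `k`) – (source up to `k`) –
(reconstruction up to `k`) holds, i.e. the two ends are conditionally independent given the
middle. -/
def IsCausal (π : Measure RSeqPair) [IsFiniteMeasure π] : Prop :=
  ∀ k : ℕ, CondIndepFun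
    (MeasurableSpace.comap (fun z : RSeqPair => pastSamples k z.1) inferInstance)
    ((measurable_pastSamples k).comp measurable_fst).comap_le
    (fun z : RSeqPair => futureSamples k z.1) (fun z : RSeqPair => pastSamples k z.2) π

/-- Information-theoretic causal rate-distortion function, in nats per sample, of a source with
law `μ`, under the average MSE constraint `D`: the infimum of the mutual information rate over all
reconstruction processes (joint laws whose source marginal is `μ`) that are causally related to the
source and have average distortion at most `D`. -/
def causalRDF (μ : Measure RSeq) (D : ℝ) : ℝ≥0∞ :=
  ⨅ (π : ProbabilityMeasure RSeqPair)
    (_ : (π : Measure RSeqPair).fst = μ ∧ IsCausal (π : Measure RSeqPair) ∧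
      avgMSE (π : Measure RSeqPair) ≤ ENNReal.ofReal D),
    mutualInfoRate (π : Measure RSeqPair)

/-- Sequential rate-distortion function with horizon `n`, in nats per sample, under the per-sample
MSE constraint `D`: the infimum of `(1/n) I(x_1^n; y_1^n)` over all reconstruction processes that
are causally related to the source and satisfy `E[(y_k - x_k)²] ≤ D` for the first `n` samples. -/
def sequentialRDF (μ : Measure RSeq) (n : ℕ) (D : ℝ) : ℝ≥0∞ :=
  ⨅ (π : ProbabilityMeasure RSeqPair)
    (_ : (π : Measure RSeqPair).fst = μ ∧ IsCausal (π : Measure RSeqPair) ∧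
      ∀ k < n, sampleMSE (π : Measure RSeqPair) k ≤ ENNReal.ofReal D),
    blockInfoRate (π : Measure RSeqPair) n

end

/-!
The lower bound and the scheme attaining it come from one explicit function. For a target
distortion `d` let `p_0 = 0`, `S_0 = q` (the source variance) and `p_{k+1} = a y_k`,
`S_{k+1} = a² d + v`, and put
  `g_n(x, y) = ∏_{k < n} N(x_k; y_k, d) / N(x_k; p_k, S_k)` (`blockDensity`).
For each fixed `y`, reweighting the law of the source by `g_n` is a Kalman filter:
the source recursion carries `N(y_k, d)` to `N(a y_k, a² d + v)`, whose density is then divided out.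
Hence `E[g_n(x, y)] = 1` for every `y` (`IsGaussMarkov.lintegral_blockDensity_mul`,
`IsGaussMarkov.lintegral_blockDensity`).

Lower bound. By the Donsker–Varadhan inequality, `I(x^n; y^n) ≥ E[log g_n(x, y)]`, and `log g_n` is
the quadratic function
  `∑ (1/2 log (S_k / d) + (x_k - p_k)² / (2 S_k) - (x_k - y_k)² / (2 d))`.
Causality enters only through the innovation `x_{k+1} - a x_k` being uncorrelated with `x_k - y_k`,
which gives `E[(x_{k+1} - a y_k)²] = a² E[(x_k - y_k)²] + v`. The bound thus depends on the mean
squared errors alone (`IsCausal.ofReal_le_mutualInfo`, `sum_lowerBound_eq`). It is at least the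
claimed value when all errors are at most `d`; under the average constraint, a smaller rate would
force the accumulated excess distortion to grow linearly (`IsGaussMarkov.le_mutualInfoRate`). No
entropy power inequality is needed.

Attainment. In the predictive coding scheme `y_k = p_k + α_k (x_k - p_k) + √(α_k d) w_k`,
`α_k = 1 - d / S_k`, with white noise `w`, Bayes' rule shows that `g_n` is the density of the law of
`(x^n, y^n)` with respect to the product of its marginals (`map_firstSamples_codedLaw`). The Kalman
filter property of `g_n` then gives the errors `E[(x_k - y_k)²] = d` and
`E[(x_k - p_k)²] = S_k`, so the information is exactly `∑ 1/2 log (S_k / d)`. When `a² d + v ≤ d`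
the source variance is at most `d` and the zero reconstruction is admissible.
-/

/-! ### Finite blocks of sequences -/

@[fun_prop]
theorem measurable_firstSamples (n : ℕ) : Measurable (firstSamples n) :=
  measurable_pi_lambda _ fun i => measurable_pi_apply (i : ℕ)

/-- Extension of a finite block by zeros to a full sequence. -/
def zeroPad (n : ℕ) (b : Fin n → ℝ) : RSeq := fun i => if h : i < n then b ⟨i, h⟩ else 0

@[fun_prop]
theorem measurable_zeroPad (n : ℕ) : Measurable (zeroPad n) := by
  refine measurable_pi_lambda _ fun i => ?_
  unfold zeroPad
  by_cases h : i < n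
  · simpa [h] using measurable_pi_apply _
  · simp [h]

theorem zeroPad_firstSamples_apply {n i : ℕ} (h : i < n) (s : RSeq) :
    zeroPad n (firstSamples n s) i = s i := by
  simp [zeroPad, firstSamples, h]

/-! ### Gaussian integrals -/

theorem lintegral_gaussianReal_of_var_ne_zero (m : ℝ) {v : ℝ≥0} (hv : v ≠ 0) {h : ℝ → ℝ≥0∞}
    (hh : Measurable h) :
    ∫⁻ r, h r ∂(gaussianReal m v) = ∫⁻ r, gaussianPDF m v r * h r := by
  rw [gaussianReal_of_var_ne_zero _ hv,
    lintegral_withDensity_eq_lintegral_mul _ (measurable_gaussianPDF _ _) hh]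
  rfl

/-- Change of measure between two nondegenerate Gaussian laws. -/
theorem lintegral_gaussianReal_div_mul (m m' : ℝ) {v v' : ℝ≥0} (hv : v ≠ 0) (hv' : v' ≠ 0)
    {h : ℝ → ℝ≥0∞} (hh : Measurable h) :
    ∫⁻ r, gaussianPDF m v r / gaussianPDF m' v' r * h r ∂(gaussianReal m' v')
      = ∫⁻ r, h r ∂(gaussianReal m v) := by
  rw [lintegral_gaussianReal_of_var_ne_zero _ hv hh,
    lintegral_gaussianReal_of_var_ne_zero _ hv'
      (h := fun r => gaussianPDF m v r / gaussianPDF m' v' r * h r)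
      (((measurable_gaussianPDF _ _).div (measurable_gaussianPDF _ _)).mul hh)]
  refine lintegral_congr fun r => ?_
  rw [← mul_assoc, ENNReal.mul_div_cancel (gaussianPDF_pos _ hv' r).ne' gaussianPDF_ne_top]

/-- A noisy linear function of a Gaussian variable is Gaussian. -/
theorem lintegral_gaussianReal_affine_noise (a m : ℝ) (d v : ℝ≥0) {h : ℝ → ℝ≥0∞}
    (hh : Measurable h) :
    ∫⁻ r, ∫⁻ t, h (a * r + t) ∂(gaussianReal 0 v) ∂(gaussianReal m d)
      = ∫⁻ r, h r ∂(gaussianReal (a * m) (NNReal.mk (a ^ 2) (sq_nonneg a) * d + v)) := by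
  have e : gaussianReal (a * m) (NNReal.mk (a ^ 2) (sq_nonneg a) * d + v)
      = (gaussianReal m d).map (a * ·) ∗ gaussianReal 0 v := by
    rw [gaussianReal_map_const_mul, gaussianReal_conv_gaussianReal, add_zero]
  rw [e, Measure.lintegral_conv hh, lintegral_map (by fun_prop) (by fun_prop)]

theorem lintegral_gaussianReal_standard (m : ℝ) (σ : ℝ) {h : ℝ → ℝ≥0∞} (hh : Measurable h) :
    ∫⁻ t, h (m + σ * t) ∂(gaussianReal 0 1)
      = ∫⁻ r, h r ∂(gaussianReal m (Real.toNNReal (σ ^ 2))) := by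
  have e : gaussianReal m (Real.toNNReal (σ ^ 2))
      = (gaussianReal 0 1).map (fun t => m + σ * t) := by
    have : (fun t => m + σ * t) = (fun t => m + t) ∘ (fun t => σ * t) := rfl
    rw [this, ← Measure.map_map (by fun_prop) (by fun_prop), gaussianReal_map_const_mul,
      gaussianReal_map_const_add]
    congr 1
    · simp
    · ext; simp [Real.coe_toNNReal _ (sq_nonneg σ)]
  rw [e, lintegral_map hh (by fun_prop)]

theorem lintegral_sq_sub_mean_gaussianReal (m : ℝ) (v : ℝ≥0) :
    ∫⁻ r, ENNReal.ofReal ((r - m) ^ 2) ∂(gaussianReal m v) = v := by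
  have h := variance_fun_id_gaussianReal (μ := m) (v := v)
  rw [variance_eq_integral (by fun_prop), integral_id_gaussianReal] at h
  rw [← ofReal_integral_eq_lintegral_ofReal, h]
  · simp
  · have := (memLp_id_gaussianReal (μ := m) (v := v) 2).sub (memLp_const m)
    exact this.integrable_sq
  · exact ae_of_all _ fun r => sq_nonneg _

/-! ### First-order Gauss–Markov laws -/

/-- `μ` is the law of a first-order Gauss–Markov sequence `s` with initial variance `q`: the
innovations `s_{k+1} - a s_k` are `N(0, v)` and independent of the past. -/
structure IsGaussMarkov (μ : Measure RSeq) (a : ℝ) (v q : ℝ≥0) : Prop where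
  map_zero : μ.map (fun s => s 0) = gaussianReal 0 q
  map_innovation (k : ℕ) : μ.map (fun s => s (k + 1) - a * s k) = gaussianReal 0 v
  indepFun_innovation (k : ℕ) :
    IndepFun (firstSamples (k + 1)) (fun s => s (k + 1) - a * s k) μ

/-- The prediction `a y_{k-1}` of the source sample `k` from the previous reconstruction. The first
sample is predicted by its mean. -/
noncomputable def pred (a : ℝ) (y : RSeq) : ℕ → ℝ
  | 0 => 0
  | k + 1 => a * y k

/-- The variance of the prediction error when the reconstruction error has variance `d`. -/
noncomputable def predVar (a : ℝ) (v q d : ℝ≥0) : ℕ → ℝ≥0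
  | 0 => q
  | _ + 1 => NNReal.mk (a ^ 2) (sq_nonneg a) * d + v

/-- The factor by which observing `y_k` changes the density of the source sample `k`: the posterior
`N(y_k, d)` against the prior `N(pred, predVar)`. -/
noncomputable def bayesFactor (a : ℝ) (v q d : ℝ≥0) (y : RSeq) (k : ℕ) (r : ℝ) : ℝ≥0∞ :=
  gaussianPDF (y k) d r / gaussianPDF (pred a y k) (predVar a v q d k) r

/-- The product of the Bayes factors of the first `n` samples. For the optimal scheme it is the
density of the joint law of source and reconstruction blocks with respect to the product of the
marginals. -/
noncomputable def blockDensity (a : ℝ) (v q d : ℝ≥0) (n : ℕ) (s y : RSeq) : ℝ≥0∞ :=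
  ∏ k ∈ Finset.range n, bayesFactor a v q d y k (s k)

@[fun_prop]
theorem measurable_pred (a : ℝ) (k : ℕ) : Measurable fun y => pred a y k := by
  cases k <;> simp only [pred] <;> fun_prop

theorem measurable_gaussianPDF_comp {α : Type*} [MeasurableSpace α] {m r : α → ℝ} (v : ℝ≥0)
    (hm : Measurable m) (hr : Measurable r) : Measurable fun z => gaussianPDF (m z) v (r z) :=
  measurable_uncurry_gaussianPDF.comp (hm.prodMk (measurable_const.prodMk hr))

@[fun_prop]
theorem measurable_bayesFactor {α : Type*} [MeasurableSpace α] (a : ℝ) (v q d : ℝ≥0) (k : ℕ)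
    {y : α → RSeq} {r : α → ℝ} (hy : Measurable y) (hr : Measurable r) :
    Measurable fun z => bayesFactor a v q d (y z) k (r z) :=
  (measurable_gaussianPDF_comp _ (by fun_prop) hr).div
    (measurable_gaussianPDF_comp _ ((measurable_pred a k).comp hy) hr)

@[fun_prop]
theorem measurable_blockDensity {α : Type*} [MeasurableSpace α] (a : ℝ) (v q d : ℝ≥0) (n : ℕ)
    {s y : α → RSeq} (hs : Measurable s) (hy : Measurable y) :
    Measurable fun z => blockDensity a v q d n (s z) (y z) :=
  Finset.measurable_prod _ fun k _ => measurable_bayesFactor a v q d k hy (by fun_prop)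

theorem pred_congr {a : ℝ} {y y' : RSeq} {n k : ℕ} (hk : k ≤ n) (hy : ∀ i < n, y i = y' i) :
    pred a y k = pred a y' k := by
  cases k with
  | zero => rfl
  | succ k => simp [pred, hy k hk]

theorem blockDensity_congr {a : ℝ} {v q d : ℝ≥0} {n : ℕ} {s s' y y' : RSeq}
    (hs : ∀ i < n, s i = s' i) (hy : ∀ i < n, y i = y' i) :
    blockDensity a v q d n s y = blockDensity a v q d n s' y' := by
  refine Finset.prod_congr rfl fun k hk => ?_
  have hk := Finset.mem_range.1 hk
  rw [bayesFactor, bayesFactor, hs k hk, hy k hk, pred_congr hk.le hy]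

theorem blockDensity_succ (a : ℝ) (v q d : ℝ≥0) (n : ℕ) (s y : RSeq) :
    blockDensity a v q d (n + 1) s y
      = blockDensity a v q d n s y * bayesFactor a v q d y n (s n) :=
  Finset.prod_range_succ _ _

theorem predVar_ne_zero {a : ℝ} {v q d : ℝ≥0} (hv : v ≠ 0) (hq : q ≠ 0) (k : ℕ) :
    predVar a v q d k ≠ 0 := by
  cases k with
  | zero => exact hq
  | succ k => exact (add_pos_of_nonneg_of_pos zero_le (pos_iff_ne_zero.2 hv)).ne'

namespace IsGaussMarkov

variable {μ : Measure RSeq} {a : ℝ} {v q d : ℝ≥0}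

theorem isProbabilityMeasure (h : IsGaussMarkov μ a v q) : IsProbabilityMeasure μ := by
  have h0 : IsProbabilityMeasure (μ.map (fun s : RSeq => s 0)) := by
    rw [h.map_zero]; infer_instance
  exact (Measure.isProbabilityMeasure_map_iff (measurable_pi_apply 0).aemeasurable).1 h0

/-- The next sample is the past scaled by `a` plus fresh Gaussian noise. -/
theorem lintegral_succ (h : IsGaussMarkov μ a v q) (n : ℕ) {F : (Fin (n + 1) → ℝ) × ℝ → ℝ≥0∞}
    (hF : Measurable F) :
    ∫⁻ s, F (firstSamples (n + 1) s, s (n + 1)) ∂μ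
      = ∫⁻ s, ∫⁻ t, F (firstSamples (n + 1) s, a * s n + t) ∂(gaussianReal 0 v) ∂μ := by
  have := h.isProbabilityMeasure
  have hind := (indepFun_iff_map_prod_eq_prod_map_map (by fun_prop) (by fun_prop)).1
    (h.indepFun_innovation n)
  rw [h.map_innovation] at hind
  let G : (Fin (n + 1) → ℝ) × ℝ → ℝ≥0∞ := fun z => F (z.1, a * z.1 (Fin.last n) + z.2)
  have hG : Measurable G := by fun_prop
  calc ∫⁻ s, F (firstSamples (n + 1) s, s (n + 1)) ∂μ
      = ∫⁻ s, G (firstSamples (n + 1) s, s (n + 1) - a * s n) ∂μ := by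
        simp [G, firstSamples]
    _ = ∫⁻ z, G z ∂((μ.map (firstSamples (n + 1))).prod (gaussianReal 0 v)) := by
        rw [← hind, lintegral_map hG (by fun_prop)]
    _ = _ := by
        rw [lintegral_prod _ hG.aemeasurable, lintegral_map (by fun_prop) (by fun_prop)]
        simp [G, firstSamples]

/-- Kalman filter, prediction step: for each fixed reconstruction `y`, reweighting the source by the
Bayes factors of the first `n` samples gives the next sample the law `N(pred, predVar)`. -/
theorem lintegral_blockDensity_mul (h : IsGaussMarkov μ a v q) (hv : v ≠ 0) (hq : q ≠ 0)
    (hd : d ≠ 0) (y : RSeq) (n : ℕ) {f : ℝ → ℝ≥0∞} (hf : Measurable f) :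
    ∫⁻ s, blockDensity a v q d n s y * f (s n) ∂μ
      = ∫⁻ r, f r ∂(gaussianReal (pred a y n) (predVar a v q d n)) := by
  induction n generalizing f with
  | zero =>
    simp only [blockDensity, Finset.range_zero, Finset.prod_empty, one_mul, pred, predVar]
    rw [← h.map_zero, lintegral_map hf (by fun_prop)]
  | succ n ih =>
    have hm : Measurable fun b : Fin (n + 1) → ℝ =>
        blockDensity a v q d (n + 1) (zeroPad (n + 1) b) y := by
      fun_prop
    have hpad (s : RSeq) : blockDensity a v q d (n + 1)
        (zeroPad (n + 1) (firstSamples (n + 1) s)) y = blockDensity a v q d (n + 1) s y :=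
      blockDensity_congr (fun i hi => zeroPad_firstSamples_apply hi s) fun _ _ => rfl
    have hb : Measurable fun r => bayesFactor a v q d y n r := by fun_prop
    have key := h.lintegral_succ n
      (F := fun z => blockDensity a v q d (n + 1) (zeroPad (n + 1) z.1) y * f z.2)
      ((hm.comp measurable_fst).mul (by fun_prop))
    simp only [hpad] at key
    rw [key]
    have hG : Measurable fun r => ∫⁻ t, f (a * r + t) ∂(gaussianReal 0 v) := by fun_prop
    calc ∫⁻ s, ∫⁻ t, blockDensity a v q d (n + 1) s y * f (a * s n + t) ∂(gaussianReal 0 v) ∂μ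
        = ∫⁻ s, blockDensity a v q d n s y *
            (bayesFactor a v q d y n (s n) * ∫⁻ t, f (a * s n + t) ∂(gaussianReal 0 v)) ∂μ := by
          refine lintegral_congr fun s => ?_
          rw [lintegral_const_mul _ (by fun_prop), blockDensity_succ, mul_assoc]
      _ = ∫⁻ r, bayesFactor a v q d y n r * ∫⁻ t, f (a * r + t) ∂(gaussianReal 0 v)
            ∂(gaussianReal (pred a y n) (predVar a v q d n)) := ih (hb.mul hG)
      _ = ∫⁻ r, ∫⁻ t, f (a * r + t) ∂(gaussianReal 0 v) ∂(gaussianReal (y n) d) :=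
          lintegral_gaussianReal_div_mul _ _ hd (predVar_ne_zero hv hq n) hG
      _ = _ := lintegral_gaussianReal_affine_noise a (y n) d v hf

/-- Kalman filter, update step: after reweighting by the Bayes factor of sample `n`, too, that
sample has the law `N(y_n, d)`. -/
theorem lintegral_blockDensity_succ_mul (h : IsGaussMarkov μ a v q) (hv : v ≠ 0) (hq : q ≠ 0)
    (hd : d ≠ 0) (y : RSeq) (n : ℕ) {f : ℝ → ℝ≥0∞} (hf : Measurable f) :
    ∫⁻ s, blockDensity a v q d (n + 1) s y * f (s n) ∂μ
      = ∫⁻ r, f r ∂(gaussianReal (y n) d) := by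
  have hb : Measurable fun r => bayesFactor a v q d y n r := by fun_prop
  simp only [blockDensity_succ, mul_assoc]
  rw [h.lintegral_blockDensity_mul hv hq hd y n (f := fun r => bayesFactor a v q d y n r * f r)
    (hb.mul hf)]
  exact lintegral_gaussianReal_div_mul _ _ hd (predVar_ne_zero hv hq n) hf

/-- For every fixed reconstruction the block density is a probability density of the source. -/
theorem lintegral_blockDensity (h : IsGaussMarkov μ a v q) (hv : v ≠ 0) (hq : q ≠ 0)
    (hd : d ≠ 0) (y : RSeq) (n : ℕ) : ∫⁻ s, blockDensity a v q d n s y ∂μ = 1 := by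
  simpa using h.lintegral_blockDensity_mul hv hq hd y n (f := fun _ => 1) measurable_const

end IsGaussMarkov

/-! ### Recursions driven by white Gaussian noise -/

/-- A sequence of independent standard Gaussian variables. -/
noncomputable def whiteNoise : Measure RSeq := Measure.infinitePi fun _ : ℕ => gaussianReal 0 1

instance : IsProbabilityMeasure whiteNoise := by unfold whiteNoise; infer_instance

/-- The first `n` samples, padded by zeros, of the sequence `y_k = m_k(y) + σ_k w_k`, where `m_k` is
evaluated at the samples of `y` before `k`, padded by zeros. -/
noncomputable def noisyRec (m : ℕ → RSeq → ℝ) (σ : ℕ → ℝ) (w : RSeq) : ℕ → RSeq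
  | 0 => 0
  | n + 1 => Function.update (noisyRec m σ w n) n (m n (noisyRec m σ w n) + σ n * w n)

/-- The sequence whose first `n` samples are those of `noisyRec m σ w n`. -/
noncomputable def noisyPath (m : ℕ → RSeq → ℝ) (σ : ℕ → ℝ) (w : RSeq) : RSeq :=
  fun k => noisyRec m σ w (k + 1) k

theorem noisyRec_apply_of_lt {m : ℕ → RSeq → ℝ} {σ : ℕ → ℝ} {w : RSeq} {n k : ℕ} (h : k < n) :
    noisyRec m σ w n k = noisyPath m σ w k := by
  induction n, (Nat.succ_le_of_lt h) using Nat.le_induction with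
  | base => rfl
  | succ n hn ih =>
    rw [noisyRec, Function.update_of_ne (by omega), ih (by omega)]

theorem noisyRec_congr {m m' : ℕ → RSeq → ℝ} {σ : ℕ → ℝ} {w w' : RSeq} {n : ℕ}
    (hm : ∀ k < n, m k = m' k) (hw : ∀ k < n, w k = w' k) :
    noisyRec m σ w n = noisyRec m' σ w' n := by
  induction n with
  | zero => rfl
  | succ n ih =>
    rw [noisyRec, noisyRec, ih (fun k hk => hm k (by omega)) (fun k hk => hw k (by omega)),
      hm n (by omega), hw n (by omega)]

theorem firstSamples_noisyPath (m : ℕ → RSeq → ℝ) (σ : ℕ → ℝ) (w : RSeq) (n : ℕ) :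
    firstSamples n (noisyPath m σ w) = firstSamples n (noisyRec m σ w n) := by
  ext i
  exact (noisyRec_apply_of_lt i.2).symm

@[fun_prop]
theorem measurable_update_comp {α : Type*} [MeasurableSpace α] (n : ℕ) {y : α → RSeq} {r : α → ℝ}
    (hy : Measurable y) (hr : Measurable r) :
    Measurable fun z => Function.update (y z) n (r z) := by
  refine measurable_pi_lambda _ fun i => ?_
  by_cases h : i = n
  · subst h; simpa using hr
  · simp only [Function.update_of_ne h]
    exact (measurable_pi_apply i).comp hy

theorem measurable_noisyRec {α : Type*} [MeasurableSpace α] {m : α → ℕ → RSeq → ℝ} (σ : ℕ → ℝ)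
    {w : α → RSeq} (hm : ∀ k, Measurable fun p : α × RSeq => m p.1 k p.2) (hw : Measurable w)
    (n : ℕ) : Measurable fun z => noisyRec (m z) σ (w z) n := by
  induction n with
  | zero => exact measurable_const
  | succ n ih =>
    have h1 : Measurable fun z => m z n (noisyRec (m z) σ (w z) n) :=
      (hm n).comp (measurable_id.prodMk ih)
    simp only [noisyRec]
    fun_prop

theorem measurable_noisyPath {α : Type*} [MeasurableSpace α] {m : α → ℕ → RSeq → ℝ} (σ : ℕ → ℝ)
    {w : α → RSeq} (hm : ∀ k, Measurable fun p : α × RSeq => m p.1 k p.2) (hw : Measurable w) :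
    Measurable fun z => noisyPath (m z) σ (w z) :=
  measurable_pi_lambda _ fun k =>
    (measurable_pi_apply k).comp (measurable_noisyRec σ hm hw (k + 1))

theorem indepFun_firstSamples_whiteNoise (n : ℕ) :
    IndepFun (firstSamples n) (fun w => w n) whiteNoise := by
  have h := iIndepFun_infinitePi (P := fun _ : ℕ => gaussianReal 0 1)
    (X := fun _ (r : ℝ) => r) (fun _ => measurable_id)
  have h2 := h.indepFun_finset (Finset.range n) {n} (by simp) (fun i => measurable_pi_apply i)
  let ψ : (({n} : Finset ℕ) → ℝ) → ℝ := fun b => b ⟨n, Finset.mem_singleton_self n⟩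
  have hψ : Measurable ψ := measurable_pi_apply _
  exact h2.comp (φ := fun b (i : Fin n) => b ⟨i, Finset.mem_range.2 i.2⟩) (by fun_prop) hψ

/-- Given its first `n` samples, sample `n` of the recursion is Gaussian. -/
theorem lintegral_noisyRec_succ {m : ℕ → RSeq → ℝ} (hm : ∀ k, Measurable (m k)) (σ : ℕ → ℝ)
    (n : ℕ) {F : RSeq → ℝ≥0∞} (hF : Measurable F) :
    ∫⁻ w, F (noisyRec m σ w (n + 1)) ∂whiteNoise
      = ∫⁻ w, ∫⁻ t, F (Function.update (noisyRec m σ w n) n (m n (noisyRec m σ w n) + σ n * t))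
          ∂(gaussianReal 0 1) ∂whiteNoise := by
  have hind := (indepFun_iff_map_prod_eq_prod_map_map (by fun_prop)
    (measurable_pi_apply n).aemeasurable).1 (indepFun_firstSamples_whiteNoise n)
  have hn : whiteNoise.map (fun w => w n) = gaussianReal 0 1 := by
    unfold whiteNoise
    exact Measure.infinitePi_map_eval _ n
  rw [hn] at hind
  have hY : Measurable fun b : Fin n → ℝ => noisyRec m σ (zeroPad n b) n :=
    measurable_noisyRec σ (fun k => (hm k).comp measurable_snd) (by fun_prop) n
  have hYw : Measurable fun w => noisyRec m σ w n :=
    measurable_noisyRec σ (fun k => (hm k).comp measurable_snd) measurable_id n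
  have hpad (w : RSeq) : noisyRec m σ (zeroPad n (firstSamples n w)) n = noisyRec m σ w n :=
    noisyRec_congr (fun _ _ => rfl) fun k hk => zeroPad_firstSamples_apply hk w
  let G : (Fin n → ℝ) × ℝ → ℝ≥0∞ := fun z =>
    F (Function.update (noisyRec m σ (zeroPad n z.1) n) n
      (m n (noisyRec m σ (zeroPad n z.1) n) + σ n * z.2))
  have hmn := hm n
  have hG : Measurable G := by fun_prop
  calc ∫⁻ w, F (noisyRec m σ w (n + 1)) ∂whiteNoise
      = ∫⁻ w, G (firstSamples n w, w n) ∂whiteNoise := by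
        simp only [G, hpad]; rfl
    _ = ∫⁻ z, G z ∂((whiteNoise.map (firstSamples n)).prod (gaussianReal 0 1)) := by
        rw [← hind, lintegral_map hG (by fun_prop)]
    _ = _ := by
        rw [lintegral_prod _ hG.aemeasurable, lintegral_map (by fun_prop) (by fun_prop)]
        simp only [G, hpad]

/-! ### Gaussian Bayes rule -/

theorem gaussianPDFReal_div (m m' : ℝ) {v v' : ℝ≥0} (hv : v ≠ 0) (hv' : v' ≠ 0) (x x' : ℝ) :
    gaussianPDFReal m v x / gaussianPDFReal m' v' x'
      = √(v' / v) * Real.exp ((x' - m') ^ 2 / (2 * v') - (x - m) ^ 2 / (2 * v)) := by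
  have h1 : (0 : ℝ) < v := by positivity
  have h2 : (0 : ℝ) < v' := by positivity
  have e : √(2 * Real.pi * v') = √(v' / v) * √(2 * Real.pi * v) := by
    rw [← Real.sqrt_mul (by positivity)]
    congr 1
    field_simp
  rw [gaussianPDFReal, gaussianPDFReal, e, sub_eq_add_neg (_ / _), Real.exp_add, neg_div, neg_div,
    Real.exp_neg ((x' - m') ^ 2 / (2 * v'))]
  have := Real.exp_pos ((x' - m') ^ 2 / (2 * v'))
  field_simp

theorem gaussianPDF_div (m m' : ℝ) {v v' : ℝ≥0} (hv : v ≠ 0) (hv' : v' ≠ 0) (x x' : ℝ) :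
    gaussianPDF m v x / gaussianPDF m' v' x' = ENNReal.ofReal
      (√(v' / v) * Real.exp ((x' - m') ^ 2 / (2 * v') - (x - m) ^ 2 / (2 * v))) := by
  rw [← gaussianPDFReal_div m m' hv hv', gaussianPDF, gaussianPDF,
    ENNReal.ofReal_div_of_pos (gaussianPDFReal_pos _ _ _ hv')]

/-- Bayes' rule for the Gaussian test channel of gain `α = 1 - d / S`: the density of the channel
law against the output law is the density of the backward channel `N(y, d)` against the input law
`N(p, S)`. -/
theorem lintegral_gaussianReal_channel (p x : ℝ) {α d S : ℝ≥0} (hα : α ≠ 0) (hd : d ≠ 0)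
    (hαS : α * S + d = S) {f : ℝ → ℝ≥0∞} (hf : Measurable f) :
    ∫⁻ r, f r ∂(gaussianReal (p + α * (x - p)) (α * d))
      = ∫⁻ r, gaussianPDF r d x / gaussianPDF p S x * f r ∂(gaussianReal p (α * S)) := by
  have hS : S ≠ 0 := by
    rintro rfl
    simp at hαS
    exact hd hαS
  rw [← lintegral_gaussianReal_div_mul _ p (mul_ne_zero hα hd) (mul_ne_zero hα hS) hf]
  refine lintegral_congr fun r => ?_
  congr 1
  rw [gaussianPDF_div _ _ (mul_ne_zero hα hd) (mul_ne_zero hα hS),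
    gaussianPDF_div _ _ hd hS]
  have h1 : (0 : ℝ) < α := by positivity
  have h2 : (0 : ℝ) < d := by positivity
  have h3 : (0 : ℝ) < S := by positivity
  have h4 : (α : ℝ) * S + d = S := by exact_mod_cast hαS
  congr 3
  · push_cast; field_simp
  · push_cast
    have : (d : ℝ) = S - α * S := by linarith
    field_simp
    rw [this]
    ring

/-! ### The predictive coding scheme -/

/-- The gain of the test channel that reduces the prediction error variance to `d`. -/
noncomputable def gain (a : ℝ) (v q d : ℝ≥0) (k : ℕ) : ℝ≥0 := 1 - d / predVar a v q d k

/-- The conditional mean of the reconstruction `y_k` given the source `x` and the past of `y`: the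
prediction corrected by the scaled prediction error. -/
noncomputable def codedMean (a : ℝ) (v q d : ℝ≥0) (x : RSeq) (k : ℕ) (y : RSeq) : ℝ :=
  pred a y k + gain a v q d k * (x k - pred a y k)

/-- The standard deviation of the channel noise in the reconstruction `y_k`. -/
noncomputable def codedStd (a : ℝ) (v q d : ℝ≥0) (k : ℕ) : ℝ := √(gain a v q d k * d : ℝ≥0)

/-- The conditional standard deviation of the reconstruction `y_k` given the past of `y`. -/
noncomputable def outputStd (a : ℝ) (v q d : ℝ≥0) (k : ℕ) : ℝ :=
  √(gain a v q d k * predVar a v q d k : ℝ≥0)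

theorem measurable_codedMean (a : ℝ) (v q d : ℝ≥0) (k : ℕ) :
    Measurable fun p : RSeq × RSeq => codedMean a v q d p.1 k p.2 := by
  have := measurable_pred a k
  unfold codedMean
  fun_prop

theorem toNNReal_sqrt_sq (c : ℝ≥0) : Real.toNNReal (√(c : ℝ) ^ 2) = c := by
  rw [Real.sq_sqrt c.coe_nonneg, Real.toNNReal_coe]

theorem gain_ne_zero {a : ℝ} {v q d : ℝ≥0} {k : ℕ} (h : d < predVar a v q d k) :
    gain a v q d k ≠ 0 := by
  rw [gain, Ne, tsub_eq_zero_iff_le, not_le]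
  exact (div_lt_one (pos_of_gt h)).2 h

theorem gain_mul_add {a : ℝ} {v q d : ℝ≥0} {k : ℕ} (h : d < predVar a v q d k) :
    gain a v q d k * predVar a v q d k + d = predVar a v q d k := by
  have hS : predVar a v q d k ≠ 0 := (pos_of_gt h).ne'
  rw [gain, tsub_mul, one_mul, div_mul_cancel₀ _ hS, tsub_add_cancel_of_le h.le]

/-- Given the source `x`, the block density is the density of the reconstruction of the predictive
coding scheme with respect to the source-independent recursion `y_k = pred + outputStd * w_k`. -/
theorem lintegral_noisyRec_codedMean {a : ℝ} {v q d : ℝ≥0} (hd : d ≠ 0)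
    (hlt : ∀ k, d < predVar a v q d k) (x : RSeq) (n : ℕ) {F : RSeq → ℝ≥0∞} (hF : Measurable F) :
    ∫⁻ w, F (noisyRec (codedMean a v q d x) (codedStd a v q d) w n) ∂whiteNoise
      = ∫⁻ w, blockDensity a v q d n x (noisyRec (fun k y => pred a y k) (outputStd a v q d) w n)
          * F (noisyRec (fun k y => pred a y k) (outputStd a v q d) w n) ∂whiteNoise := by
  induction n generalizing F with
  | zero => simp [noisyRec, blockDensity]
  | succ n ih =>
    have hcm : ∀ k, Measurable (codedMean a v q d x k) := fun k =>
      (measurable_codedMean a v q d k).comp (measurable_const.prodMk measurable_id)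
    have hcmn := hcm n
    rw [lintegral_noisyRec_succ hcm _ n hF, lintegral_noisyRec_succ (measurable_pred a) _ n
      (F := fun y => blockDensity a v q d (n + 1) x y * F y) (by fun_prop)]
    rw [ih (F := fun y => ∫⁻ t, F (Function.update y n
      (codedMean a v q d x n y + codedStd a v q d n * t)) ∂(gaussianReal 0 1)) (by fun_prop)]
    refine lintegral_congr fun w => ?_
    set y := noisyRec (fun k y => pred a y k) (outputStd a v q d) w n
    rw [lintegral_gaussianReal_standard _ _ (h := fun r => F (Function.update y n r))
        (by fun_prop),
      lintegral_gaussianReal_standard _ _ (h := fun r => blockDensity a v q d (n + 1) x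
        (Function.update y n r) * F (Function.update y n r)) (by fun_prop),
      codedStd, outputStd, toNNReal_sqrt_sq, toNNReal_sqrt_sq, codedMean,
      lintegral_gaussianReal_channel _ _ (gain_ne_zero (hlt n)) hd (gain_mul_add (hlt n))
        (by fun_prop),
      ← lintegral_const_mul]
    · refine lintegral_congr fun r => ?_
      have hy : ∀ i < n, Function.update y n r i = y i := fun i hi =>
        Function.update_of_ne hi.ne _ _
      rw [blockDensity_succ, bayesFactor, pred_congr le_rfl hy, Function.update_self,
        blockDensity_congr (fun _ _ => rfl) hy, mul_assoc]
    · refine Measurable.mul (Measurable.div ?_ ?_) (by fun_prop)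
      · exact measurable_gaussianPDF_comp _ measurable_id measurable_const
      · exact measurable_const

/-- The joint law of the source and its reconstruction by the predictive coding scheme. -/
noncomputable def codedLaw (μ : Measure RSeq) (a : ℝ) (v q d : ℝ≥0) : Measure RSeqPair :=
  (μ.prod whiteNoise).map fun z =>
    (z.1, noisyPath (codedMean a v q d z.1) (codedStd a v q d) z.2)

theorem measurable_codedPath (a : ℝ) (v q d : ℝ≥0) :
    Measurable fun z : RSeqPair => noisyPath (codedMean a v q d z.1) (codedStd a v q d) z.2 :=
  measurable_noisyPath _ (fun k => (measurable_codedMean a v q d k).comp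
    (by fun_prop : Measurable fun p : RSeqPair × RSeq => (p.1.1, p.2))) measurable_snd

/-- The law of the first `n` samples, padded by zeros, of the recursion
`y_k = pred + outputStd * w_k`. The reconstruction of the predictive coding scheme has the same
law. -/
noncomputable def outputLaw (a : ℝ) (v q d : ℝ≥0) (n : ℕ) : Measure RSeq :=
  whiteNoise.map fun w => noisyRec (fun k y => pred a y k) (outputStd a v q d) w n

theorem measurable_outputRec (a : ℝ) (v q d : ℝ≥0) (n : ℕ) :
    Measurable fun w => noisyRec (fun k y => pred a y k) (outputStd a v q d) w n :=
  measurable_noisyRec _ (fun k => (measurable_pred a k).comp measurable_snd) measurable_id n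

instance (a : ℝ) (v q d : ℝ≥0) (n : ℕ) : IsProbabilityMeasure (outputLaw a v q d n) :=
  Measure.isProbabilityMeasure_map (measurable_outputRec a v q d n).aemeasurable

/-- Integration against the joint law of the source and the first `n` reconstructed samples. -/
theorem lintegral_codedLaw (μ : Measure RSeq) [IsProbabilityMeasure μ] {a : ℝ} {v q d : ℝ≥0}
    (hd : d ≠ 0) (hlt : ∀ k, d < predVar a v q d k) (n : ℕ) {F : RSeq → (Fin n → ℝ) → ℝ≥0∞}
    (hF : Measurable (Function.uncurry F)) :
    ∫⁻ z, F z.1 (firstSamples n z.2) ∂(codedLaw μ a v q d)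
      = ∫⁻ y, ∫⁻ s, blockDensity a v q d n s y * F s (firstSamples n y) ∂μ
          ∂(outputLaw a v q d n) := by
  have h1 : Measurable fun z : RSeqPair => F z.1 (firstSamples n z.2) :=
    hF.comp (by fun_prop : Measurable fun z : RSeqPair => (z.1, firstSamples n z.2))
  have hm := measurable_codedPath a v q d
  have h2 : Measurable fun z : RSeqPair => blockDensity a v q d n z.2 z.1
      * F z.2 (firstSamples n z.1) :=
    Measurable.mul (by fun_prop)
      (hF.comp (by fun_prop : Measurable fun z : RSeqPair => (z.2, firstSamples n z.1)))
  have h3 (s : RSeq) : Measurable fun y => F s (firstSamples n y) :=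
    h1.comp (by fun_prop : Measurable fun y : RSeq => (s, y))
  have hr := measurable_outputRec a v q d n
  rw [codedLaw, lintegral_map h1 (by fun_prop), lintegral_prod _ (by fun_prop)]
  simp only [firstSamples_noisyPath]
  rw [outputLaw, lintegral_map h2.lintegral_prod_right' hr]
  symm
  rw [lintegral_lintegral_swap]
  · refine lintegral_congr fun s => ?_
    exact (lintegral_noisyRec_codedMean hd hlt s n (h3 s)).symm
  · exact (h2.comp (by fun_prop : Measurable fun z : RSeqPair =>
      (noisyRec (fun k y => pred a y k) (outputStd a v q d) z.1 n, z.2))).aemeasurable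

/-! ### Two facts about the Kullback–Leibler divergence -/

/-- Donsker–Varadhan inequality, for a test function with `∫ exp ℓ ≤ 1`. -/
theorem ofReal_integral_le_klDiv {α : Type*} [MeasurableSpace α] {P Q : Measure α}
    [IsProbabilityMeasure P] [IsProbabilityMeasure Q] {ℓ : α → ℝ} (hℓ : Measurable ℓ)
    (hint : Integrable ℓ P) (hexp : ∫⁻ z, ENNReal.ofReal (Real.exp (ℓ z)) ∂Q ≤ 1) :
    ENNReal.ofReal (∫ z, ℓ z ∂P) ≤ klDiv P Q := by
  by_cases htop : klDiv P Q = ∞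
  · simp [htop]
  obtain ⟨hac, hllr⟩ := klDiv_ne_top_iff.1 htop
  have hexpint : Integrable (fun z => Real.exp (ℓ z)) Q := by
    refine ⟨by fun_prop, ?_⟩
    rw [hasFiniteIntegral_iff_ofReal (ae_of_all _ fun z => (Real.exp_pos _).le)]
    exact hexp.trans_lt ENNReal.one_lt_top
  have hexp1 : ∫ z, Real.exp (ℓ z) ∂Q ≤ 1 := by
    rw [integral_eq_lintegral_of_nonneg_ae (ae_of_all _ fun z => (Real.exp_pos _).le) (by fun_prop)]
    exact ENNReal.toReal_le_of_le_ofReal zero_le_one (by simpa using hexp)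
  rw [klDiv_of_ac_of_integrable hac hllr]
  refine ENNReal.ofReal_le_ofReal ?_
  have : IsProbabilityMeasure (Q.tilted ℓ) := isProbabilityMeasure_tilted hexpint
  -- Gibbs' inequality for `P` against the tilted measure `exp ℓ • Q`
  have h0 := integral_llr_add_sub_measure_univ_nonneg
    (hac.trans (absolutelyContinuous_tilted hexpint))
    (integrable_llr_tilted_right hac hint hllr hexpint)
  rw [integral_llr_tilted_right hac hint hexpint hllr] at h0
  have hlog : Real.log (∫ z, Real.exp (ℓ z) ∂Q) ≤ 0 :=
    Real.log_nonpos (integral_nonneg fun z => (Real.exp_pos _).le) hexp1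
  simp only [probReal_univ] at h0 ⊢
  linarith

theorem klDiv_withDensity_exp {α : Type*} [MeasurableSpace α] {Q : Measure α}
    [IsProbabilityMeasure Q] {ℓ : α → ℝ} (hℓ : Measurable ℓ)
    [IsProbabilityMeasure (Q.withDensity fun z => ENNReal.ofReal (Real.exp (ℓ z)))]
    (hint : Integrable ℓ (Q.withDensity fun z => ENNReal.ofReal (Real.exp (ℓ z)))) :
    klDiv (Q.withDensity fun z => ENNReal.ofReal (Real.exp (ℓ z))) Q
      = ENNReal.ofReal (∫ z, ℓ z ∂(Q.withDensity fun z => ENNReal.ofReal (Real.exp (ℓ z)))) := by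
  set P := Q.withDensity fun z => ENNReal.ofReal (Real.exp (ℓ z))
  have hac : P ≪ Q := withDensity_absolutelyContinuous _ _
  have hllr : llr P Q =ᵐ[P] ℓ := by
    filter_upwards [hac.ae_le (Measure.rnDeriv_withDensity Q
      (f := fun z => ENNReal.ofReal (Real.exp (ℓ z))) (by fun_prop))] with z hz
    rw [llr, hz, ENNReal.toReal_ofReal (Real.exp_pos _).le, Real.log_exp]
  rw [klDiv_of_ac_of_integrable hac (hint.congr hllr.symm), integral_congr_ae hllr]
  simp

/-! ### The logarithm of the block density -/

/-- The logarithm of `blockDensity`, a quadratic function of the prediction errors `s_k - pred` and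
the reconstruction errors `s_k - y_k`. -/
noncomputable def logBlockDensity (a : ℝ) (v q d : ℝ≥0) (n : ℕ) (s y : RSeq) : ℝ :=
  ∑ k ∈ Finset.range n, (1 / 2 * Real.log (predVar a v q d k / d)
    + (s k - pred a y k) ^ 2 / (2 * predVar a v q d k) - (s k - y k) ^ 2 / (2 * d))

@[fun_prop]
theorem measurable_logBlockDensity {α : Type*} [MeasurableSpace α] (a : ℝ) (v q d : ℝ≥0) (n : ℕ)
    {s y : α → RSeq} (hs : Measurable s) (hy : Measurable y) :
    Measurable fun z => logBlockDensity a v q d n (s z) (y z) := by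
  have h (k : ℕ) : Measurable fun z => pred a (y z) k := (measurable_pred a k).comp hy
  unfold logBlockDensity
  fun_prop

theorem ofReal_exp_logBlockDensity {a : ℝ} {v q d : ℝ≥0} (hv : v ≠ 0) (hq : q ≠ 0) (hd : d ≠ 0)
    (n : ℕ) (s y : RSeq) :
    ENNReal.ofReal (Real.exp (logBlockDensity a v q d n s y)) = blockDensity a v q d n s y := by
  rw [logBlockDensity, Real.exp_sum, ENNReal.ofReal_prod_of_nonneg fun _ _ => (Real.exp_pos _).le,
    blockDensity]
  refine Finset.prod_congr rfl fun k _ => ?_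
  have hS := predVar_ne_zero (a := a) (d := d) hv hq k
  rw [bayesFactor, gaussianPDF_div _ _ hd hS, add_sub_assoc, Real.exp_add]
  have h2 : (0 : ℝ) < predVar a v q d k / d := by positivity
  congr 2
  rw [Real.sqrt_eq_rpow, Real.rpow_def_of_pos h2, mul_comm]

theorem logBlockDensity_congr {a : ℝ} {v q d : ℝ≥0} {n : ℕ} {s s' y y' : RSeq}
    (hs : ∀ i < n, s i = s' i) (hy : ∀ i < n, y i = y' i) :
    logBlockDensity a v q d n s y = logBlockDensity a v q d n s' y' := by
  refine Finset.sum_congr rfl fun k hk => ?_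
  have hk := Finset.mem_range.1 hk
  rw [hs k hk, hy k hk, pred_congr hk.le hy]

/-- The expectation of the log density in terms of the second moments `U k` of the prediction errors
and `M k` of the reconstruction errors. -/
theorem integral_logBlockDensity {π : Measure RSeqPair} [IsProbabilityMeasure π] (a : ℝ)
    (v q d : ℝ≥0) (n : ℕ) {U M : ℕ → ℝ}
    (hU : ∀ k < n, Integrable (fun z => (z.1 k - pred a z.2 k) ^ 2) π)
    (hU' : ∀ k < n, ∫ z, (z.1 k - pred a z.2 k) ^ 2 ∂π = U k)
    (hM : ∀ k < n, Integrable (fun z => (z.1 k - z.2 k) ^ 2) π)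
    (hM' : ∀ k < n, ∫ z, (z.1 k - z.2 k) ^ 2 ∂π = M k) :
    Integrable (fun z => logBlockDensity a v q d n z.1 z.2) π ∧
    ∫ z, logBlockDensity a v q d n z.1 z.2 ∂π
      = ∑ k ∈ Finset.range n, (1 / 2 * Real.log (predVar a v q d k / d)
          + U k / (2 * predVar a v q d k) - M k / (2 * d)) := by
  have hi (k : ℕ) (hk : k < n) : Integrable (fun z : RSeqPair =>
      1 / 2 * Real.log (predVar a v q d k / d)
        + (z.1 k - pred a z.2 k) ^ 2 / (2 * predVar a v q d k)) π :=
    (integrable_const _).add ((hU k hk).div_const _)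
  have hi' (k : ℕ) (hk : k ∈ Finset.range n) : Integrable (fun z : RSeqPair =>
      1 / 2 * Real.log (predVar a v q d k / d)
        + (z.1 k - pred a z.2 k) ^ 2 / (2 * predVar a v q d k)
        - (z.1 k - z.2 k) ^ 2 / (2 * d)) π :=
    (hi k (Finset.mem_range.1 hk)).sub ((hM k (Finset.mem_range.1 hk)).div_const _)
  unfold logBlockDensity
  refine ⟨integrable_finsetSum _ hi', ?_⟩
  rw [integral_finsetSum _ hi']
  refine Finset.sum_congr rfl fun k hk => ?_
  have hk := Finset.mem_range.1 hk
  rw [integral_sub (hi k hk) ((hM k hk).div_const _), integral_add (integrable_const _)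
    ((hU k hk).div_const _), integral_div, integral_div, hU' k hk, hM' k hk]
  simp

theorem integrable_sq_of_lintegral {α : Type*} [MeasurableSpace α] {P : Measure α} {f : α → ℝ}
    (hf : Measurable f) {c : ℝ≥0∞} (hc : c ≠ ∞) (h : ∫⁻ z, ENNReal.ofReal (f z ^ 2) ∂P = c) :
    Integrable (fun z => f z ^ 2) P ∧ ∫ z, f z ^ 2 ∂P = c.toReal := by
  constructor
  · refine ⟨by fun_prop, ?_⟩
    rw [hasFiniteIntegral_iff_ofReal (ae_of_all _ fun z => sq_nonneg _), h]
    exact hc.lt_top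
  · rw [integral_eq_lintegral_of_nonneg_ae (ae_of_all _ fun z => sq_nonneg _) (by fun_prop), h]

/-! ### Rate and distortion of the predictive coding scheme -/

section Coded

variable {μ : Measure RSeq} {a : ℝ} {v q d : ℝ≥0}

instance [IsProbabilityMeasure μ] : IsProbabilityMeasure (codedLaw μ a v q d) :=
  Measure.isProbabilityMeasure_map
    (measurable_fst.prodMk (measurable_codedPath a v q d)).aemeasurable

theorem fst_codedLaw [IsProbabilityMeasure μ] : (codedLaw μ a v q d).fst = μ := by
  rw [codedLaw, Measure.fst_map_prodMk (measurable_codedPath a v q d)]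
  exact Measure.fst_prod

/-- The reconstruction error of every sample has second moment exactly `d`. -/
theorem sampleMSE_codedLaw (h : IsGaussMarkov μ a v q) (hv : v ≠ 0) (hq : q ≠ 0) (hd : d ≠ 0)
    (hlt : ∀ k, d < predVar a v q d k) (k : ℕ) : sampleMSE (codedLaw μ a v q d) k = d := by
  have := h.isProbabilityMeasure
  have key := lintegral_codedLaw μ hd hlt (k + 1)
    (F := fun s b => ENNReal.ofReal ((b (Fin.last k) - s k) ^ 2)) (by fun_prop)
  simp only [firstSamples, Fin.val_last] at key
  rw [sampleMSE, key]
  calc _ = ∫⁻ y, (d : ℝ≥0∞) ∂(outputLaw a v q d (k + 1)) := by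
        refine lintegral_congr fun y => ?_
        rw [h.lintegral_blockDensity_succ_mul hv hq hd y k
          (f := fun r => ENNReal.ofReal ((y k - r) ^ 2)) (by fun_prop),
          ← lintegral_sq_sub_mean_gaussianReal (y k) d]
        refine lintegral_congr fun r => ?_
        rw [← neg_sub, neg_sq]
    _ = d := by simp

theorem lintegral_predictionError_codedLaw (h : IsGaussMarkov μ a v q) (hv : v ≠ 0) (hq : q ≠ 0)
    (hd : d ≠ 0) (hlt : ∀ k, d < predVar a v q d k) (k : ℕ) :
    ∫⁻ z, ENNReal.ofReal ((z.1 k - pred a z.2 k) ^ 2) ∂(codedLaw μ a v q d)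
      = predVar a v q d k := by
  have := h.isProbabilityMeasure
  have hm := measurable_pred a k
  have key := lintegral_codedLaw μ hd hlt k
    (F := fun s b => ENNReal.ofReal ((s k - pred a (zeroPad k b) k) ^ 2)) (by fun_prop)
  have hpad (y : RSeq) : pred a (zeroPad k (firstSamples k y)) k = pred a y k :=
    pred_congr le_rfl fun i hi => zeroPad_firstSamples_apply hi y
  simp only [hpad] at key
  rw [key]
  calc _ = ∫⁻ y, (predVar a v q d k : ℝ≥0∞) ∂(outputLaw a v q d k) := by
        refine lintegral_congr fun y => ?_
        rw [h.lintegral_blockDensity_mul hv hq hd y k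
          (f := fun r => ENNReal.ofReal ((r - pred a y k) ^ 2)) (by fun_prop),
          lintegral_sq_sub_mean_gaussianReal]
    _ = _ := by simp

theorem map_firstSamples_snd_codedLaw (h : IsGaussMarkov μ a v q) (hv : v ≠ 0) (hq : q ≠ 0)
    (hd : d ≠ 0) (hlt : ∀ k, d < predVar a v q d k) (n : ℕ) :
    (codedLaw μ a v q d).map (fun z => firstSamples n z.2)
      = (outputLaw a v q d n).map (firstSamples n) := by
  have := h.isProbabilityMeasure
  refine Measure.ext_of_lintegral _ fun f hf => ?_
  rw [lintegral_map hf (by fun_prop), lintegral_map hf (by fun_prop),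
    lintegral_codedLaw μ hd hlt n (F := fun _ b => f b) (by fun_prop)]
  refine lintegral_congr fun y => ?_
  rw [lintegral_mul_const _ (by fun_prop), h.lintegral_blockDensity hv hq hd, one_mul]

/-- The block density is the density of the joint law of the blocks with respect to the product of
the marginal laws. -/
theorem map_firstSamples_codedLaw (h : IsGaussMarkov μ a v q) (hv : v ≠ 0) (hq : q ≠ 0)
    (hd : d ≠ 0) (hlt : ∀ k, d < predVar a v q d k) (n : ℕ) :
    (codedLaw μ a v q d).map (fun z => (firstSamples n z.1, firstSamples n z.2))
      = (((codedLaw μ a v q d).map fun z => firstSamples n z.1).prod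
          ((codedLaw μ a v q d).map fun z => firstSamples n z.2)).withDensity fun b =>
            ENNReal.ofReal (Real.exp
              (logBlockDensity a v q d n (zeroPad n b.1) (zeroPad n b.2))) := by
  have := h.isProbabilityMeasure
  have hfst : (codedLaw μ a v q d).map (fun z => firstSamples n z.1) = μ.map (firstSamples n) := by
    conv_rhs => rw [← fst_codedLaw (μ := μ) (a := a) (v := v) (q := q) (d := d)]
    rw [Measure.fst, Measure.map_map (by fun_prop) measurable_fst]
    rfl
  rw [map_firstSamples_snd_codedLaw h hv hq hd hlt, hfst]
  have : IsProbabilityMeasure (μ.map (firstSamples n)) :=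
    Measure.isProbabilityMeasure_map (by fun_prop)
  have : IsProbabilityMeasure ((outputLaw a v q d n).map (firstSamples n)) :=
    Measure.isProbabilityMeasure_map (by fun_prop)
  refine Measure.ext_of_lintegral _ fun f hf => ?_
  rw [lintegral_map hf (by fun_prop), lintegral_withDensity_eq_lintegral_mul _ (by fun_prop) hf,
    lintegral_codedLaw μ hd hlt n (F := fun s b => f (firstSamples n s, b)) (by fun_prop),
    lintegral_prod_symm _ (by fun_prop), lintegral_map (by fun_prop) (by fun_prop)]
  refine lintegral_congr fun y => ?_
  rw [lintegral_map (by fun_prop) (by fun_prop)]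
  refine lintegral_congr fun s => ?_
  rw [Pi.mul_apply, ofReal_exp_logBlockDensity hv hq hd,
    blockDensity_congr (fun i hi => zeroPad_firstSamples_apply hi s)
      (fun i hi => zeroPad_firstSamples_apply hi y)]

/-- The information between the blocks of source and reconstruction in the predictive coding
scheme. -/
theorem mutualInfo_codedLaw (h : IsGaussMarkov μ a v q) (hv : v ≠ 0) (hq : q ≠ 0)
    (hd : d ≠ 0) (hlt : ∀ k, d < predVar a v q d k) (n : ℕ) :
    mutualInfo (codedLaw μ a v q d) (fun z => firstSamples n z.1) (fun z => firstSamples n z.2)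
      = ENNReal.ofReal (∑ k ∈ Finset.range n, 1 / 2 * Real.log (predVar a v q d k / d)) := by
  have := h.isProbabilityMeasure
  have hU (k : ℕ) := integrable_sq_of_lintegral (P := codedLaw μ a v q d)
    (f := fun z => z.1 k - pred a z.2 k) (by have := measurable_pred a k; fun_prop)
    ENNReal.coe_ne_top (lintegral_predictionError_codedLaw h hv hq hd hlt k)
  have hM (k : ℕ) := integrable_sq_of_lintegral (P := codedLaw μ a v q d)
    (f := fun z => z.2 k - z.1 k) (by fun_prop)
    ENNReal.coe_ne_top (sampleMSE_codedLaw h hv hq hd hlt k)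
  have hsymm (k : ℕ) (z : RSeqPair) : (z.2 k - z.1 k) ^ 2 = (z.1 k - z.2 k) ^ 2 := by ring
  simp only [hsymm] at hM
  obtain ⟨hint, hval⟩ := integral_logBlockDensity (π := codedLaw μ a v q d) a v q d n
    (fun k _ => (hU k).1) (fun k _ => (hU k).2) (fun k _ => (hM k).1) (fun k _ => (hM k).2)
  have hJ := map_firstSamples_codedLaw h hv hq hd hlt n
  have hp1 : IsProbabilityMeasure ((codedLaw μ a v q d).map fun z => firstSamples n z.1) :=
    Measure.isProbabilityMeasure_map (by fun_prop)
  have hp2 : IsProbabilityMeasure ((codedLaw μ a v q d).map fun z => firstSamples n z.2) :=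
    Measure.isProbabilityMeasure_map (by fun_prop)
  have hp3 : IsProbabilityMeasure ((codedLaw μ a v q d).map
      fun z => (firstSamples n z.1, firstSamples n z.2)) :=
    Measure.isProbabilityMeasure_map (by fun_prop)
  have hpad (z : RSeqPair) : logBlockDensity a v q d n (zeroPad n (firstSamples n z.1))
      (zeroPad n (firstSamples n z.2)) = logBlockDensity a v q d n z.1 z.2 :=
    logBlockDensity_congr (fun i hi => zeroPad_firstSamples_apply hi z.1)
      (fun i hi => zeroPad_firstSamples_apply hi z.2)
  have hint' : Integrable (fun b : (Fin n → ℝ) × (Fin n → ℝ) =>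
      logBlockDensity a v q d n (zeroPad n b.1) (zeroPad n b.2))
      ((codedLaw μ a v q d).map fun z => (firstSamples n z.1, firstSamples n z.2)) := by
    rw [integrable_map_measure (Measurable.aestronglyMeasurable (by fun_prop)) (by fun_prop)]
    simpa only [Function.comp_def, hpad] using hint
  have hval' : ∫ b, logBlockDensity a v q d n (zeroPad n b.1) (zeroPad n b.2)
      ∂((codedLaw μ a v q d).map fun z => (firstSamples n z.1, firstSamples n z.2))
      = ∫ z, logBlockDensity a v q d n z.1 z.2 ∂(codedLaw μ a v q d) := by
    rw [integral_map (by fun_prop) (Measurable.aestronglyMeasurable (by fun_prop))]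
    simp only [hpad]
  rw [mutualInfo, hJ]
  rw [hJ] at hp3 hint' hval'
  rw [klDiv_withDensity_exp (by fun_prop) hint', hval', hval]
  congr 1
  refine Finset.sum_congr rfl fun k _ => ?_
  have hS := predVar_ne_zero (a := a) (d := d) hv hq k
  have h1 : (predVar a v q d k : ℝ) ≠ 0 := by exact_mod_cast hS
  have h2 : (d : ℝ) ≠ 0 := by exact_mod_cast hd
  simp only [ENNReal.coe_toReal]
  field_simp
  ring

end Coded

/-! ### Causality -/

/-- If `y` is a function of the source and of independent noise, then the conditional probability of
`y ∈ t` given the whole source is obtained by integrating out the noise. -/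
theorem condExp_indicator_comap_fst {μ ν : Measure RSeq} [IsProbabilityMeasure μ]
    [IsProbabilityMeasure ν] {Y : RSeqPair → RSeq} (hY : Measurable Y) {t : Set RSeq}
    (ht : MeasurableSet t) :
    ((μ.prod ν).map fun z => (z.1, Y z))⟦Prod.snd ⁻¹' t |
        MeasurableSpace.comap Prod.fst inferInstance⟧
      =ᵐ[(μ.prod ν).map fun z => (z.1, Y z)] fun z => ν.real {w | Y (z.1, w) ∈ t} := by
  set π := (μ.prod ν).map fun z => (z.1, Y z) with hπ
  have : IsProbabilityMeasure π := Measure.isProbabilityMeasure_map (by fun_prop)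
  have hφ : Measurable fun s => ν {w | Y (s, w) ∈ t} := measurable_measure_prodMk_left (hY ht)
  have hφr : Measurable fun s => ν.real {w | Y (s, w) ∈ t} := hφ.ennreal_toReal
  have hφi : Integrable (fun z : RSeqPair => ν.real {w | Y (z.1, w) ∈ t}) π :=
    Integrable.of_bound (hφr.comp measurable_fst).aestronglyMeasurable 1
      (ae_of_all _ fun z => by
        rw [Real.norm_of_nonneg measureReal_nonneg]; exact measureReal_le_one)
  refine (ae_eq_condExp_of_forall_setIntegral_eq measurable_fst.comap_le ?_ ?_ ?_ ?_).symm
  · exact (integrable_const (1 : ℝ)).indicator (measurable_snd ht)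
  · exact fun _ _ _ => hφi.integrableOn
  · rintro _ ⟨c, hc, rfl⟩ -
    have h1 : π (Prod.snd ⁻¹' t ∩ Prod.fst ⁻¹' c) = ∫⁻ s in c, ν {w | Y (s, w) ∈ t} ∂μ := by
      rw [hπ, Measure.map_apply (by fun_prop) ((measurable_snd ht).inter (measurable_fst hc)),
        Measure.prod_apply ((measurable_fst.prodMk hY)
          ((measurable_snd ht).inter (measurable_fst hc))), ← lintegral_indicator hc]
      refine lintegral_congr fun s => ?_
      by_cases hs : s ∈ c
      · simp [hs, Set.preimage]
      · simp [hs, Set.preimage]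
    have h2 : ∫⁻ z in Prod.fst ⁻¹' c, ν {w | Y (z.1, w) ∈ t} ∂π
        = ∫⁻ s in c, ν {w | Y (s, w) ∈ t} ∂μ := by
      have hfst : π.map Prod.fst = μ := by
        rw [← Measure.fst, hπ, Measure.fst_map_prodMk hY]
        exact Measure.fst_prod
      conv_rhs => rw [← hfst]
      rw [setLIntegral_map hc hφ measurable_fst]
    rw [integral_indicator (measurable_snd ht)]
    simp only [measureReal_def]
    rw [integral_toReal (f := fun z : RSeqPair => ν {w | Y (z.1, w) ∈ t})
      (hφ.comp measurable_fst).aemeasurable (ae_of_all _ fun z => measure_lt_top _ _), h2, ← h1]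
    simp [measureReal_def, Measure.restrict_restrict (measurable_snd ht)]
  · refine (Measurable.stronglyMeasurable ?_).aestronglyMeasurable
    exact hφr.comp (comap_measurable Prod.fst)

/-- If the conditional probability of `B` given the finer σ-algebra `M` is measurable with respect
to `m'`, then `B` is conditionally independent of every event of `M` given `m'`. -/
theorem condExp_inter_eq_mul_of_stronglyMeasurable {Ω : Type*} {m' M : MeasurableSpace Ω}
    [mΩ : MeasurableSpace Ω] {π : Measure Ω} [IsProbabilityMeasure π] (hm'M : m' ≤ M) (hM : M ≤ mΩ)
    {A B : Set Ω} (hA : MeasurableSet[M] A) (hB : MeasurableSet B) {φ : Ω → ℝ}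
    (hφ : π⟦B | M⟧ =ᵐ[π] φ) (hφm : StronglyMeasurable[m'] φ) (hφ1 : ∀ z, ‖φ z‖ ≤ 1) :
    π⟦A ∩ B | m'⟧ =ᵐ[π] fun z => (π⟦A | m'⟧) z * (π⟦B | m'⟧) z := by
  have hm' : m' ≤ mΩ := hm'M.trans hM
  have hφi : Integrable φ π := Integrable.of_bound
    (hφm.mono hm').aestronglyMeasurable 1 (ae_of_all _ hφ1)
  have hAi : Integrable (A.indicator fun _ => (1 : ℝ)) π :=
    (integrable_const 1).indicator (hM _ hA)
  have hBi : Integrable (B.indicator fun _ => (1 : ℝ)) π := (integrable_const 1).indicator hB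
  have hAB : (A ∩ B).indicator (fun _ => (1 : ℝ))
      = (A.indicator fun _ => (1 : ℝ)) * B.indicator fun _ => (1 : ℝ) := by
    ext z
    by_cases h1 : z ∈ A <;> by_cases h2 : z ∈ B <;> simp [h1, h2]
  have hA1 : ∀ z, ‖A.indicator (fun _ => (1 : ℝ)) z‖ ≤ 1 := fun z => by
    by_cases h : z ∈ A <;> simp [h]
  have hBφ : π⟦B | m'⟧ =ᵐ[π] φ := by
    refine (condExp_condExp_of_le hm'M hM).symm.trans ((condExp_congr_ae hφ).trans ?_)
    rw [condExp_of_stronglyMeasurable hm' hφm hφi]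
  have hABM : π⟦A ∩ B | M⟧ =ᵐ[π] φ * A.indicator fun _ => (1 : ℝ) := by
    rw [hAB]
    refine (condExp_stronglyMeasurable_mul_of_bound hM
      (stronglyMeasurable_const.indicator hA) hBi 1 (ae_of_all _ hA1)).trans ?_
    filter_upwards [hφ] with z hz
    rw [Pi.mul_apply, Pi.mul_apply, hz, mul_comm]
  calc π⟦A ∩ B | m'⟧ =ᵐ[π] π[φ * A.indicator (fun _ => (1 : ℝ)) | m'] :=
        (condExp_condExp_of_le hm'M hM).symm.trans (condExp_congr_ae hABM)
    _ =ᵐ[π] φ * π⟦A | m'⟧ :=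
        condExp_stronglyMeasurable_mul_of_bound hm' hφm hAi 1 (ae_of_all _ hφ1)
    _ =ᵐ[π] fun z => (π⟦A | m'⟧) z * (π⟦B | m'⟧) z := by
        filter_upwards [hBφ] with z hz
        rw [Pi.mul_apply, hz, mul_comm]

/-- A reconstruction driven by noise independent of the source, whose samples up to `k` depend only
on the source samples up to `k` and the noise, is causally related to the source. -/
theorem isCausal_map_of_dependsOn {μ ν : Measure RSeq} [IsProbabilityMeasure μ]
    [IsProbabilityMeasure ν] {Y : RSeqPair → RSeq} (hY : Measurable Y)
    (hdep : ∀ (k : ℕ) (s s' w : RSeq), (∀ i < k + 1, s i = s' i) →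
      ∀ i < k + 1, Y (s, w) i = Y (s', w) i)
    [IsProbabilityMeasure ((μ.prod ν).map fun z => (z.1, Y z))] :
    IsCausal ((μ.prod ν).map fun z => (z.1, Y z)) := by
  intro k
  have hpast := measurable_pastSamples k
  have hfut : Measurable (futureSamples k) := measurable_pi_lambda _ fun i => measurable_pi_apply _
  refine (condIndepFun_iff_condExp_inter_preimage_eq_mul (hfut.comp measurable_fst)
    (hpast.comp measurable_snd)).2 fun S T hS hT => ?_
  have hle : MeasurableSpace.comap (fun z : RSeqPair => pastSamples k z.1) inferInstance
      ≤ MeasurableSpace.comap Prod.fst inferInstance := by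
    rintro _ ⟨c, hc, rfl⟩
    exact ⟨pastSamples k ⁻¹' c, hpast hc, rfl⟩
  refine condExp_inter_eq_mul_of_stronglyMeasurable hle measurable_fst.comap_le
    ⟨futureSamples k ⁻¹' S, hfut hS, rfl⟩ ((hpast.comp measurable_snd) hT)
    (condExp_indicator_comap_fst hY (hpast hT)) ?_ fun z => ?_
  · -- the conditional probability depends only on the past of the source
    let ext : (Set.Iic k → ℝ) → RSeq := fun b i => if h : i ≤ k then b ⟨i, h⟩ else 0
    have hext : Measurable ext := by
      refine measurable_pi_lambda _ fun i => ?_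
      by_cases h : i ≤ k
      · simpa [ext, h] using measurable_pi_apply _
      · simp [ext, h]
    have hφ' : (fun z : RSeqPair => ν.real {w | Y (z.1, w) ∈ pastSamples k ⁻¹' T})
        = (fun b => ν.real {w | pastSamples k (Y (ext b, w)) ∈ T}) ∘
          fun z : RSeqPair => pastSamples k z.1 := by
      ext z
      simp only [Function.comp_apply]
      congr 1
      ext w
      have : pastSamples k (Y (z.1, w)) = pastSamples k (Y (ext (pastSamples k z.1), w)) := by
        ext i
        refine hdep k _ _ w (fun j hj => ?_) i (Nat.lt_succ_of_le i.2)
        simp [ext, pastSamples, Nat.le_of_lt_succ hj]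
      rw [Set.mem_ofPred_eq, Set.mem_ofPred_eq, Set.mem_preimage, this]
    have hmeas : Measurable fun b => ν.real {w | pastSamples k (Y (ext b, w)) ∈ T} := by
      refine Measurable.ennreal_toReal ?_
      have : MeasurableSet {p : (Set.Iic k → ℝ) × RSeq | pastSamples k (Y (ext p.1, p.2)) ∈ T} :=
        (hpast.comp (hY.comp (by fun_prop :
          Measurable fun p : (Set.Iic k → ℝ) × RSeq => (ext p.1, p.2)))) hT
      exact measurable_measure_prodMk_left this
    rw [hφ']
    exact (hmeas.comp (comap_measurable _)).stronglyMeasurable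
  · rw [Real.norm_of_nonneg measureReal_nonneg]
    exact measureReal_le_one

theorem isCausal_codedLaw (μ : Measure RSeq) [IsProbabilityMeasure μ] (a : ℝ) (v q d : ℝ≥0) :
    IsCausal (codedLaw μ a v q d) := by
  have : IsProbabilityMeasure ((μ.prod whiteNoise).map fun z =>
    (z.1, noisyPath (codedMean a v q d z.1) (codedStd a v q d) z.2)) :=
    inferInstanceAs (IsProbabilityMeasure (codedLaw μ a v q d))
  refine isCausal_map_of_dependsOn
    (Y := fun z => noisyPath (codedMean a v q d z.1) (codedStd a v q d) z.2)
    (measurable_codedPath a v q d) fun k s s' w hs i hi => ?_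
  refine congrFun (noisyRec_congr (fun j hj => ?_) fun _ _ => rfl) i
  ext y
  simp only [codedMean, hs j (by omega)]

/-- A variable that differs from `c` by centered noise independent of `Z` has conditional mean `c`
given `Z`, when `c` is a function of `Z`. -/
theorem condExp_comap_eq_of_indepFun_sub {Ω β : Type*} [MeasurableSpace Ω] [mβ : MeasurableSpace β]
    {π : Measure Ω} [IsProbabilityMeasure π] {X c : Ω → ℝ} {Z : Ω → β} (hXm : Measurable X)
    (hcm : Measurable c) (hZ : Measurable Z) (hX : Integrable X π) (hc : Integrable c π)
    (hcZ : StronglyMeasurable[mβ.comap Z] c) (hind : IndepFun (X - c) Z π)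
    (hmean : ∫ z, (X - c) z ∂π = 0) : π[X | mβ.comap Z] =ᵐ[π] c := by
  have h3 : π[X - c | mβ.comap Z] =ᵐ[π] fun _ => ∫ z, (X - c) z ∂π :=
    condExp_indep_eq (hXm.sub hcm).comap_le hZ.comap_le
      (comap_measurable (X - c)).stronglyMeasurable hind
  have h4 := condExp_sub hX hc (mβ.comap Z)
  rw [condExp_of_stronglyMeasurable hZ.comap_le hcZ hc] at h4
  filter_upwards [h3, h4] with z hz3 hz4
  rw [hz3, hmean, Pi.sub_apply] at hz4
  linarith

/-- For conditionally independent `X` and `Y`, the first factor of `E[X Y]` may be replaced by its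
conditional mean. -/
theorem integral_mul_eq_of_condIndepFun {Ω : Type*} {m' : MeasurableSpace Ω}
    [mΩ : MeasurableSpace Ω] [StandardBorelSpace Ω] (hm' : m' ≤ mΩ) {π : Measure Ω}
    [IsProbabilityMeasure π] {X Y c : Ω → ℝ} (hXm : Measurable X) (hYm : Measurable Y)
    (hX : MemLp X 2 π) (hY : MemLp Y 2 π) (hc : MemLp c 2 π) (hcm : StronglyMeasurable[m'] c)
    (hcond : π[X | m'] =ᵐ[π] c) (hci : CondIndepFun m' hm' X Y π) :
    ∫ z, X z * Y z ∂π = ∫ z, c z * Y z ∂π := by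
  have hYi := hY.integrable one_le_two
  have hXY : Integrable (fun z => X z * Y z) π := hX.integrable_mul hY
  have hcY : Integrable (fun z => c z * Y z) π := hc.integrable_mul hY
  have hprod : π[fun z => X z * Y z | m'] =ᵐ[π] fun z => (π[X | m']) z * (π[Y | m']) z := by
    have hker := ae_of_ae_trim hm'
      ((condIndepFun_iff_map_prod_eq_prod_map_map hXm hYm).1 hci)
    filter_upwards [hker, condExp_ae_eq_integral_condExpKernel hm' hXY,
      condExp_ae_eq_integral_condExpKernel hm' (hX.integrable one_le_two),
      condExp_ae_eq_integral_condExpKernel hm' hYi] with z h1 h2 h3 h4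
    rw [h2, h3, h4]
    rw [Kernel.map_apply _ (by fun_prop), Kernel.prod_apply, Kernel.map_apply _ hXm,
      Kernel.map_apply _ hYm] at h1
    exact IndepFun.integral_fun_mul_eq_mul_integral
      ((indepFun_iff_map_prod_eq_prod_map_map hXm.aemeasurable hYm.aemeasurable).2 h1)
      hXm.aestronglyMeasurable hYm.aestronglyMeasurable
  have hpull : π[fun z => c z * Y z | m'] =ᵐ[π] c * π[Y | m'] :=
    condExp_mul_of_stronglyMeasurable_left hcm hcY hYi
  rw [← integral_condExp hm', ← integral_condExp hm' (f := fun z => c z * Y z)]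
  refine integral_congr_ae ?_
  filter_upwards [hprod, hpull, hcond] with z h1 h2 h3
  rw [h1, h2, h3, Pi.mul_apply]

/-- In a causal pair, the innovation of the source is uncorrelated with the current
reconstruction. -/
theorem IsCausal.integral_innovation_mul {π : Measure RSeqPair} [IsProbabilityMeasure π]
    (hπ : IsCausal π) {a : ℝ} {v q : ℝ≥0} (h : IsGaussMarkov π.fst a v q)
    (k : ℕ) (hx : ∀ j, MemLp (fun z : RSeqPair => z.1 j) 2 π)
    (hy : MemLp (fun z : RSeqPair => z.2 k) 2 π) :
    ∫ z, (z.1 (k + 1) - a * z.1 k) * z.2 k ∂π = 0 := by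
  have hpast := measurable_pastSamples k
  have hmk : StronglyMeasurable[MeasurableSpace.comap (fun z : RSeqPair => pastSamples k z.1)
      inferInstance] fun z : RSeqPair => a * z.1 k := by
    have h1 : Measurable fun b : Set.Iic k → ℝ => b ⟨k, Set.self_mem_Iic⟩ := measurable_pi_apply _
    exact ((h1.const_mul a).comp
      (comap_measurable fun z : RSeqPair => pastSamples k z.1)).stronglyMeasurable
  have hax : MemLp (fun z : RSeqPair => a * z.1 k) 2 π := (hx k).const_mul a
  have hinn : Measurable fun s : RSeq => s (k + 1) - a * s k := by fun_prop
  have hcond : π[fun z => z.1 (k + 1) | MeasurableSpace.comap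
      (fun z : RSeqPair => pastSamples k z.1) inferInstance] =ᵐ[π] fun z => a * z.1 k := by
    refine condExp_comap_eq_of_indepFun_sub (by fun_prop) (by fun_prop)
      (hpast.comp measurable_fst) ((hx _).integrable one_le_two) (hax.integrable one_le_two) hmk
      ?_ ?_
    · have h1 : IndepFun (fun s : RSeq => s (k + 1) - a * s k) (pastSamples k) π.fst := by
        have hφ : Measurable fun (b : Fin (k + 1) → ℝ) (i : Set.Iic k) =>
            b ⟨i, Nat.lt_succ_of_le i.2⟩ := measurable_pi_lambda _ fun i => measurable_pi_apply _
        exact ((h.indepFun_innovation k).comp hφ measurable_id).symm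
      rw [Measure.fst, indepFun_iff_measure_inter_preimage_eq_mul] at h1
      rw [indepFun_iff_measure_inter_preimage_eq_mul]
      intro s t hs ht
      have := h1 s t hs ht
      rw [Measure.map_apply measurable_fst ((hinn hs).inter (hpast ht)),
        Measure.map_apply measurable_fst (hinn hs), Measure.map_apply measurable_fst (hpast ht)]
        at this
      exact this
    · have h2 : ∫ r, r ∂(π.fst.map fun s => s (k + 1) - a * s k) = 0 := by
        rw [h.map_innovation, integral_id_gaussianReal]
      rw [Measure.fst, Measure.map_map hinn measurable_fst,
        integral_map (hinn.comp measurable_fst).aemeasurable (by fun_prop)] at h2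
      exact h2
  have hci : CondIndepFun (MeasurableSpace.comap (fun z : RSeqPair => pastSamples k z.1)
      inferInstance) (hpast.comp measurable_fst).comap_le (fun z : RSeqPair => z.1 (k + 1))
      (fun z => z.2 k) π := by
    let φ : (Set.Ioi k → ℝ) → ℝ := fun b => b ⟨k + 1, Set.mem_Ioi.2 k.lt_succ_self⟩
    let ψ : (Set.Iic k → ℝ) → ℝ := fun b => b ⟨k, Set.self_mem_Iic⟩
    exact (hπ k).comp (φ := φ) (ψ := ψ) (measurable_pi_apply _) (measurable_pi_apply _)
  have hEq := integral_mul_eq_of_condIndepFun (hpast.comp measurable_fst).comap_le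
    (X := fun z : RSeqPair => z.1 (k + 1)) (Y := fun z => z.2 k) (by fun_prop) (by fun_prop)
    (hx _) hy hax hmk hcond hci
  have h1 : Integrable (fun z : RSeqPair => z.1 (k + 1) * z.2 k) π := (hx _).integrable_mul hy
  have h2 : Integrable (fun z : RSeqPair => a * z.1 k * z.2 k) π := hax.integrable_mul hy
  simp only [sub_mul]
  rw [integral_sub h1 h2, hEq, sub_self]

/-! ### The converse for finite blocks -/

theorem memLp_two_of_map_gaussianReal {Ω : Type*} [MeasurableSpace Ω] {P : Measure Ω} {X : Ω → ℝ}
    (hX : Measurable X) {m : ℝ} {v : ℝ≥0} (h : P.map X = gaussianReal m v) : MemLp X 2 P := by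
  have h2 : MemLp id 2 (P.map X) := h ▸ memLp_id_gaussianReal 2
  exact (memLp_map_measure_iff (by fun_prop) hX.aemeasurable).1 h2

theorem integral_sq_of_map_gaussianReal {Ω : Type*} [MeasurableSpace Ω] {P : Measure Ω} {X : Ω → ℝ}
    (hX : Measurable X) {v : ℝ≥0} (h : P.map X = gaussianReal 0 v) : ∫ z, X z ^ 2 ∂P = v := by
  have h1 := variance_fun_id_gaussianReal (μ := 0) (v := v)
  rw [variance_eq_integral (by fun_prop), integral_id_gaussianReal, ← h,
    integral_map hX.aemeasurable (by fun_prop)] at h1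
  simpa using h1

theorem integral_of_map_gaussianReal {Ω : Type*} [MeasurableSpace Ω] {P : Measure Ω} {X : Ω → ℝ}
    (hX : Measurable X) {m : ℝ} {v : ℝ≥0} (h : P.map X = gaussianReal m v) : ∫ z, X z ∂P = m := by
  have h1 := integral_id_gaussianReal (μ := m) (v := v)
  rwa [← h, integral_map hX.aemeasurable (by fun_prop)] at h1

namespace IsGaussMarkov

variable {μ : Measure RSeq} {a : ℝ} {v q : ℝ≥0}

theorem memLp_two (h : IsGaussMarkov μ a v q) (k : ℕ) : MemLp (fun s : RSeq => s k) 2 μ := by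
  induction k with
  | zero => exact memLp_two_of_map_gaussianReal (by fun_prop) h.map_zero
  | succ k ih =>
    have h1 := memLp_two_of_map_gaussianReal (by fun_prop) (h.map_innovation k)
    have h2 := h1.add (ih.const_mul a)
    refine h2.ae_eq (ae_of_all _ fun s => ?_)
    simp

theorem integral_innovation_mul_self (h : IsGaussMarkov μ a v q) (k : ℕ) :
    ∫ s, (s (k + 1) - a * s k) * s k ∂μ = 0 := by
  have hind : IndepFun (fun s : RSeq => s k) (fun s : RSeq => s (k + 1) - a * s k) μ := by
    have hφ : Measurable fun b : Fin (k + 1) → ℝ => b (Fin.last k) := measurable_pi_apply _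
    exact (h.indepFun_innovation k).comp hφ measurable_id
  rw [hind.symm.integral_fun_mul_eq_mul_integral (Measurable.aestronglyMeasurable (by fun_prop))
    (Measurable.aestronglyMeasurable (by fun_prop)),
    integral_of_map_gaussianReal (by fun_prop) (h.map_innovation k), zero_mul]

end IsGaussMarkov

/-- The second moment of the prediction error of a causal reconstruction whose errors have second
moments `M`. -/
def predMSE (a : ℝ) (v q : ℝ≥0) (M : ℕ → ℝ) : ℕ → ℝ
  | 0 => q
  | k + 1 => a ^ 2 * M k + v

/-- Since the innovation is uncorrelated with the reconstruction error, the prediction error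
`s_{k+1} - a y_k = (s_{k+1} - a s_k) + a (s_k - y_k)` has second moment `v + a² E[(s_k - y_k)²]`. -/
theorem IsCausal.integral_sq_predictionError {π : Measure RSeqPair} [IsProbabilityMeasure π]
    (hπ : IsCausal π) {a : ℝ} {v q : ℝ≥0} (h : IsGaussMarkov π.fst a v q) {M : ℕ → ℝ} {n : ℕ}
    (hM : ∀ k < n, Integrable (fun z => (z.1 k - z.2 k) ^ 2) π)
    (hM' : ∀ k < n, ∫ z, (z.1 k - z.2 k) ^ 2 ∂π = M k) (k : ℕ) (hk : k < n) :
    Integrable (fun z => (z.1 k - pred a z.2 k) ^ 2) π ∧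
      ∫ z, (z.1 k - pred a z.2 k) ^ 2 ∂π = predMSE a v q M k := by
  have hx (j : ℕ) : MemLp (fun z : RSeqPair => z.1 j) 2 π := by
    have := h.memLp_two j
    exact (memLp_map_measure_iff (Measurable.aestronglyMeasurable (by fun_prop))
      measurable_fst.aemeasurable).1 this
  cases k with
  | zero =>
    have h0 : π.map (fun z => z.1 0) = gaussianReal 0 q := by
      rw [← h.map_zero, Measure.fst, Measure.map_map (by fun_prop) measurable_fst]
      rfl
    simp only [pred, sub_zero, predMSE]
    exact ⟨(hx 0).integrable_sq, integral_sq_of_map_gaussianReal (by fun_prop) h0⟩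
  | succ k =>
    have hk : k < n := by omega
    have he : MemLp (fun z : RSeqPair => z.1 k - z.2 k) 2 π :=
      (memLp_two_iff_integrable_sq (Measurable.aestronglyMeasurable (by fun_prop))).2 (hM k hk)
    have hy : MemLp (fun z : RSeqPair => z.2 k) 2 π :=
      ((hx k).sub he).ae_eq (ae_of_all _ fun z => by simp)
    have hlaw : π.map (fun z => z.1 (k + 1) - a * z.1 k) = gaussianReal 0 v := by
      rw [← h.map_innovation k, Measure.fst, Measure.map_map (by fun_prop) measurable_fst]
      rfl
    have hξ : MemLp (fun z : RSeqPair => z.1 (k + 1) - a * z.1 k) 2 π :=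
      memLp_two_of_map_gaussianReal (by fun_prop) hlaw
    have hξ2 := integral_sq_of_map_gaussianReal (by fun_prop) hlaw
    have hξx : ∫ z, (z.1 (k + 1) - a * z.1 k) * z.1 k ∂π = 0 := by
      have := h.integral_innovation_mul_self k
      rwa [Measure.fst, integral_map measurable_fst.aemeasurable
        (Measurable.aestronglyMeasurable (by fun_prop))] at this
    have hξy := hπ.integral_innovation_mul h k hx hy
    have hexp (z : RSeqPair) : (z.1 (k + 1) - pred a z.2 (k + 1)) ^ 2
        = (z.1 (k + 1) - a * z.1 k) ^ 2 + 2 * a * ((z.1 (k + 1) - a * z.1 k) * z.1 k)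
          - 2 * a * ((z.1 (k + 1) - a * z.1 k) * z.2 k) + a ^ 2 * (z.1 k - z.2 k) ^ 2 := by
      simp only [pred]
      ring
    have i1 : Integrable (fun z : RSeqPair => (z.1 (k + 1) - a * z.1 k) ^ 2) π := hξ.integrable_sq
    have i2 : Integrable (fun z : RSeqPair =>
        2 * a * ((z.1 (k + 1) - a * z.1 k) * z.1 k)) π := (hξ.integrable_mul (hx k)).const_mul _
    have i3 : Integrable (fun z : RSeqPair =>
        2 * a * ((z.1 (k + 1) - a * z.1 k) * z.2 k)) π := (hξ.integrable_mul hy).const_mul _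
    have i4 : Integrable (fun z : RSeqPair => a ^ 2 * (z.1 k - z.2 k) ^ 2) π :=
      (hM k hk).const_mul _
    simp only [hexp, predMSE]
    refine ⟨((i1.add i2).sub i3).add i4, ?_⟩
    have i12 : Integrable (fun z : RSeqPair => (z.1 (k + 1) - a * z.1 k) ^ 2
        + 2 * a * ((z.1 (k + 1) - a * z.1 k) * z.1 k)) π := i1.add i2
    have i123 : Integrable (fun z : RSeqPair => (z.1 (k + 1) - a * z.1 k) ^ 2
        + 2 * a * ((z.1 (k + 1) - a * z.1 k) * z.1 k)
        - 2 * a * ((z.1 (k + 1) - a * z.1 k) * z.2 k)) π := i12.sub i3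
    rw [integral_add i123 i4, integral_sub i12 i3, integral_add i1 i2, integral_const_mul,
      integral_const_mul, integral_const_mul, hξ2, hξx, hξy, hM' k hk]
    ring

/-- The block density is a test function in the Donsker–Varadhan inequality because its source
average is one for every reconstruction; causality evaluates its mean logarithm. -/
theorem IsCausal.ofReal_le_mutualInfo {π : Measure RSeqPair} [IsProbabilityMeasure π]
    (hπ : IsCausal π) {a : ℝ} {v q d : ℝ≥0} (h : IsGaussMarkov π.fst a v q) (hv : v ≠ 0)
    (hq : q ≠ 0) (hd : d ≠ 0) {n : ℕ} (hfin : ∀ k < n, sampleMSE π k ≠ ∞) :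
    ENNReal.ofReal (∑ k ∈ Finset.range n, (1 / 2 * Real.log (predVar a v q d k / d)
        + predMSE a v q (fun k => (sampleMSE π k).toReal) k / (2 * predVar a v q d k)
        - (sampleMSE π k).toReal / (2 * d)))
      ≤ mutualInfo π (fun z => firstSamples n z.1) (fun z => firstSamples n z.2) := by
  have hM (k : ℕ) (hk : k < n) := integrable_sq_of_lintegral (P := π)
    (f := fun z => z.2 k - z.1 k) (by fun_prop) (hfin k hk) rfl
  have hsymm (k : ℕ) (z : RSeqPair) : (z.2 k - z.1 k) ^ 2 = (z.1 k - z.2 k) ^ 2 := by ring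
  simp only [hsymm] at hM
  have hU := hπ.integral_sq_predictionError h (fun k hk => (hM k hk).1) (fun k hk => (hM k hk).2)
  obtain ⟨hint, hval⟩ := integral_logBlockDensity a v q d n (fun k hk => (hU k hk).1)
    (fun k hk => (hU k hk).2) (fun k hk => (hM k hk).1) (fun k hk => (hM k hk).2)
  rw [← hval]
  have hp1 : IsProbabilityMeasure (π.map fun z => firstSamples n z.1) :=
    Measure.isProbabilityMeasure_map (by fun_prop)
  have hp2 : IsProbabilityMeasure (π.map fun z => firstSamples n z.2) :=
    Measure.isProbabilityMeasure_map (by fun_prop)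
  have hp3 : IsProbabilityMeasure (π.map fun z => (firstSamples n z.1, firstSamples n z.2)) :=
    Measure.isProbabilityMeasure_map (by fun_prop)
  have hpad (s y : RSeq) : logBlockDensity a v q d n (zeroPad n (firstSamples n s))
      (zeroPad n (firstSamples n y)) = logBlockDensity a v q d n s y :=
    logBlockDensity_congr (fun i hi => zeroPad_firstSamples_apply hi s)
      (fun i hi => zeroPad_firstSamples_apply hi y)
  have hfst : (π.map fun z => firstSamples n z.1) = π.fst.map (firstSamples n) := by
    rw [Measure.fst, Measure.map_map (by fun_prop) measurable_fst]
    rfl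
  have hsnd : (π.map fun z => firstSamples n z.2) = π.snd.map (firstSamples n) := by
    rw [Measure.snd, Measure.map_map (by fun_prop) measurable_snd]
    rfl
  have key := ofReal_integral_le_klDiv
    (P := π.map fun z => (firstSamples n z.1, firstSamples n z.2))
    (Q := (π.map fun z => firstSamples n z.1).prod (π.map fun z => firstSamples n z.2))
    (ℓ := fun b => logBlockDensity a v q d n (zeroPad n b.1) (zeroPad n b.2)) (by fun_prop) ?_ ?_
  · rw [integral_map (by fun_prop) (Measurable.aestronglyMeasurable (by fun_prop))] at key
    simp only [hpad] at key
    exact key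
  · rw [integrable_map_measure (Measurable.aestronglyMeasurable (by fun_prop)) (by fun_prop)]
    simpa only [Function.comp_def, hpad] using hint
  · rw [lintegral_prod_symm _ (by fun_prop), hfst, hsnd, lintegral_map (by fun_prop) (by fun_prop)]
    calc _ = ∫⁻ y, 1 ∂π.snd := by
          refine lintegral_congr fun y => ?_
          rw [lintegral_map (by fun_prop) (by fun_prop),
            ← h.lintegral_blockDensity hv hq hd y n]
          refine lintegral_congr fun s => ?_
          rw [hpad, ofReal_exp_logBlockDensity hv hq hd]
      _ ≤ 1 := by simp

/-! ### The law of the source -/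

theorem indepFun_prodMk_of_indepFun {Ω α β γ : Type*} [MeasurableSpace Ω] [MeasurableSpace α]
    [MeasurableSpace β] [MeasurableSpace γ] {P : Measure Ω} [IsProbabilityMeasure P] {A : Ω → α}
    {B : Ω → β} {C : Ω → γ} (hA : Measurable A) (hB : Measurable B) (hC : Measurable C)
    (h : IndepFun A (fun ω => (B ω, C ω)) P) (h' : IndepFun B C P) :
    IndepFun (fun ω => (A ω, B ω)) C P := by
  have hAB : IndepFun A B P := h.comp measurable_id measurable_fst
  have := Measure.isProbabilityMeasure_map (μ := P) hA.aemeasurable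
  have := Measure.isProbabilityMeasure_map (μ := P) hB.aemeasurable
  have := Measure.isProbabilityMeasure_map (μ := P) hC.aemeasurable
  rw [indepFun_iff_map_prod_eq_prod_map_map (by fun_prop) (by fun_prop)] at h h' hAB ⊢
  rw [hAB, ← (measurePreserving_prodAssoc (P.map A) (P.map B) (P.map C)).symm.map_eq, ← h', ← h,
    Measure.map_map (by fun_prop) (by fun_prop)]
  rfl

/-- The first-order autoregression with initial value `r` driven by `w`. -/
def autoregression (a : ℝ) (r : ℝ) (w : RSeq) : RSeq
  | 0 => r
  | k + 1 => a * autoregression a r w k + w k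

theorem autoregression_congr {a r : ℝ} {w w' : RSeq} {n : ℕ} (h : ∀ i < n, w i = w' i) :
    autoregression a r w n = autoregression a r w' n := by
  induction n with
  | zero => rfl
  | succ n ih => rw [autoregression, autoregression, ih fun i hi => h i (by omega), h n (by omega)]

@[fun_prop]
theorem measurable_autoregression {α : Type*} [MeasurableSpace α] (a : ℝ) {r : α → ℝ}
    {w : α → RSeq} (hr : Measurable r) (hw : Measurable w) :
    Measurable fun z => autoregression a (r z) (w z) := by
  refine measurable_pi_lambda _ fun n => ?_
  induction n with
  | zero => exact hr
  | succ n ih => simp only [autoregression]; fun_prop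

theorem isGaussMarkov_map_autoregression {Ω : Type*} [MeasurableSpace Ω] {P : Measure Ω}
    [IsProbabilityMeasure P] (a : ℝ) {v q : ℝ≥0} {x₀ : Ω → ℝ} {ξ : ℕ → Ω → ℝ}
    (hx₀ : Measurable x₀) (hξ : ∀ k, Measurable (ξ k))
    (hξ_law : ∀ k, P.map (ξ k) = gaussianReal 0 v) (hξ_indep : iIndepFun ξ P)
    (hx_law : P.map x₀ = gaussianReal 0 q)
    (hx_indep : IndepFun x₀ (fun ω k => ξ k ω) P) :
    IsGaussMarkov (P.map fun ω => autoregression a (x₀ ω) fun k => ξ k ω) a v q where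
  map_zero := by
    rw [Measure.map_map (by fun_prop) (by fun_prop), ← hx_law]
    rfl
  map_innovation k := by
    rw [Measure.map_map (by fun_prop) (by fun_prop), ← hξ_law k]
    congr 1
    ext ω
    simp [autoregression]
  indepFun_innovation k := by
    have hpast : IndepFun (fun ω => (x₀ ω, fun i : Fin k => ξ i ω)) (ξ k) P := by
      refine indepFun_prodMk_of_indepFun hx₀ (by fun_prop) (hξ k) ?_ ?_
      · have hφ : Measurable fun w : ℕ → ℝ => ((fun i : Fin k => w i), w k) := by fun_prop
        exact hx_indep.comp measurable_id hφ
      · have h2 := hξ_indep.indepFun_finset (Finset.range k) {k} (by simp) hξ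
        let ψ : (({k} : Finset ℕ) → ℝ) → ℝ := fun b => b ⟨k, Finset.mem_singleton_self k⟩
        have hψ : Measurable ψ := measurable_pi_apply _
        exact h2.comp (φ := fun b (i : Fin k) => b ⟨i, Finset.mem_range.2 i.2⟩) (by fun_prop) hψ
    have hΦ : Measurable fun p : ℝ × (Fin k → ℝ) =>
        firstSamples (k + 1) (autoregression a p.1 (zeroPad k p.2)) := by fun_prop
    have hind := hpast.comp hΦ measurable_id
    have heq (ω : Ω) : firstSamples (k + 1) (autoregression a (x₀ ω)
          (zeroPad k fun i : Fin k => ξ i ω))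
        = firstSamples (k + 1) (autoregression a (x₀ ω) fun j => ξ j ω) := by
      ext i
      refine autoregression_congr fun j hj => ?_
      have hjk : j < k := by have := i.2; omega
      simp [zeroPad, hjk]
    rw [indepFun_iff_measure_inter_preimage_eq_mul] at hind ⊢
    intro s t hs ht
    have hm : Measurable fun ω => autoregression a (x₀ ω) fun j => ξ j ω := by fun_prop
    have hinn : Measurable fun s : RSeq => s (k + 1) - a * s k := by fun_prop
    have hfs := measurable_firstSamples (k + 1)
    rw [Measure.map_apply hm ((hfs hs).inter (hinn ht)), Measure.map_apply hm (hfs hs),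
      Measure.map_apply hm (hinn ht)]
    have := hind s t hs ht
    have e1 : (fun ω => autoregression a (x₀ ω) fun j => ξ j ω) ⁻¹' (firstSamples (k + 1) ⁻¹' s)
        = ((fun p : ℝ × (Fin k → ℝ) => firstSamples (k + 1)
          (autoregression a p.1 (zeroPad k p.2))) ∘
          fun ω => (x₀ ω, fun i : Fin k => ξ i ω)) ⁻¹' s := by
      ext ω
      simp only [Set.mem_preimage, Function.comp_apply, heq]
    have e2 : (fun ω => autoregression a (x₀ ω) fun j => ξ j ω) ⁻¹'
        ((fun s : RSeq => s (k + 1) - a * s k) ⁻¹' t) = (id ∘ ξ k) ⁻¹' t := by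
      ext ω
      simp [autoregression]
    rw [Set.preimage_inter, e1, e2]
    exact this

/-- A process satisfying the Gauss–Markov recursion almost surely has a Gauss–Markov law. -/
theorem isGaussMarkov_map_of_recursion {Ω : Type*} [MeasurableSpace Ω] {P : Measure Ω}
    [IsProbabilityMeasure P] {a : ℝ} {v q : ℝ≥0} {x ξ : ℕ → Ω → ℝ}
    (hξ_law : ∀ k, HasLaw (ξ k) (gaussianReal 0 v) P) (hξ_indep : iIndepFun ξ P)
    (hx_init : HasLaw (x 0) (gaussianReal 0 q) P)
    (hx_indep : IndepFun (x 0) (fun ω k => ξ k ω) P)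
    (hx_rec : ∀ k, ∀ᵐ ω ∂P, x (k + 1) ω = a * x k ω + ξ k ω) :
    IsGaussMarkov (P.map fun ω k => x k ω) a v q := by
  have hξ := fun k => (hξ_law k).aemeasurable
  have hx := hx_init.aemeasurable
  have hx0 : x 0 =ᵐ[P] hx.mk (x 0) := hx.ae_eq_mk
  have hξ0 (k : ℕ) : ξ k =ᵐ[P] (hξ k).mk (ξ k) := (hξ k).ae_eq_mk
  have hpath : (fun ω k => x k ω) =ᵐ[P]
      fun ω => autoregression a (hx.mk (x 0) ω) fun k => (hξ k).mk (ξ k) ω := by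
    filter_upwards [hx0, ae_all_iff.2 hξ0, ae_all_iff.2 hx_rec] with ω h1 h2 h3
    ext k
    induction k with
    | zero => exact h1
    | succ k ih => rw [h3, autoregression, ← ih, h2]
  have hseq : (fun ω k => ξ k ω) =ᵐ[P] fun ω k => (hξ k).mk (ξ k) ω := by
    filter_upwards [ae_all_iff.2 hξ0] with ω h
    ext k
    exact h k
  rw [Measure.map_congr hpath]
  refine isGaussMarkov_map_autoregression a hx.measurable_mk (fun k => (hξ k).measurable_mk)
    (fun k => ?_) (hξ_indep.congr hξ0) ?_ (hx_indep.congr hx0 hseq)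
  · rw [← (hξ_law k).map_eq, Measure.map_congr (hξ0 k)]
  · rw [← hx_init.map_eq, Measure.map_congr hx0]

/-! ### The zero-rate regime -/

/-- The joint law of the source and the zero reconstruction. -/
noncomputable def zeroLaw (μ : Measure RSeq) : Measure RSeqPair :=
  (μ.prod whiteNoise).map fun z => (z.1, 0)

theorem fst_zeroLaw {μ : Measure RSeq} : (zeroLaw μ).fst = μ := by
  rw [zeroLaw, Measure.fst_map_prodMk measurable_const]
  exact Measure.fst_prod

section Zero

variable {μ : Measure RSeq} [IsProbabilityMeasure μ]

instance : IsProbabilityMeasure (zeroLaw μ) :=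
  Measure.isProbabilityMeasure_map (by fun_prop)

theorem isCausal_zeroLaw : IsCausal (zeroLaw μ) := by
  have : IsProbabilityMeasure ((μ.prod whiteNoise).map fun z : RSeqPair => (z.1, (0 : RSeq))) :=
    inferInstanceAs (IsProbabilityMeasure (zeroLaw μ))
  exact isCausal_map_of_dependsOn (Y := fun _ => 0) measurable_const fun _ _ _ _ _ _ _ => rfl

theorem blockInfoRate_zeroLaw (n : ℕ) : blockInfoRate (zeroLaw μ) n = 0 := by
  have hae : (fun _ : RSeqPair => firstSamples n 0) =ᵐ[zeroLaw μ] fun z => firstSamples n z.2 := by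
    have hm : MeasurableSet {z : RSeqPair | firstSamples n 0 = firstSamples n z.2} :=
      measurableSet_eq_fun measurable_const (by fun_prop)
    exact (ae_map_iff (by fun_prop) hm).2 (ae_of_all _ fun _ => rfl)
  have hind : IndepFun (fun z : RSeqPair => firstSamples n z.1) (fun z => firstSamples n z.2)
      (zeroLaw μ) := (indepFun_const_right _ (firstSamples n 0)).congr ae_eq_rfl hae
  have hp : IsProbabilityMeasure ((zeroLaw μ).map fun z => firstSamples n z.1) :=
    Measure.isProbabilityMeasure_map (by fun_prop)
  have hp2 : IsProbabilityMeasure ((zeroLaw μ).map fun z => firstSamples n z.2) :=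
    Measure.isProbabilityMeasure_map (by fun_prop)
  rw [blockInfoRate, mutualInfo,
    (indepFun_iff_map_prod_eq_prod_map_map (by fun_prop) (by fun_prop)).1 hind, klDiv_self,
    ENNReal.zero_div]

theorem sampleMSE_zeroLaw_le {a : ℝ} {v q : ℝ≥0} {D : ℝ} (h : IsGaussMarkov μ a v q)
    (hq : q ≤ D) (hD : a ^ 2 * D + v ≤ D) (k : ℕ) :
    sampleMSE (zeroLaw μ) k ≤ ENNReal.ofReal D := by
  have hx (j : ℕ) : MemLp (fun z : RSeqPair => z.1 j) 2 (zeroLaw μ) := by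
    have := h.memLp_two j
    rw [← fst_zeroLaw (μ := μ)] at this
    exact (memLp_map_measure_iff (Measurable.aestronglyMeasurable (by fun_prop))
      measurable_fst.aemeasurable).1 this
  have hae (j : ℕ) : ∀ᵐ z ∂(zeroLaw μ), z.2 j = 0 := by
    have hm : MeasurableSet {z : RSeqPair | z.2 j = 0} :=
      measurableSet_eq_fun (by fun_prop) measurable_const
    exact (ae_map_iff (by fun_prop) hm).2 (ae_of_all _ fun _ => rfl)
  have hMi (j : ℕ) : Integrable (fun z : RSeqPair => (z.1 j - z.2 j) ^ 2) (zeroLaw μ) := by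
    refine (hx j).integrable_sq.congr ?_
    filter_upwards [hae j] with z hz
    rw [hz, sub_zero]
  have h' : IsGaussMarkov (zeroLaw μ).fst a v q := by rwa [fst_zeroLaw]
  -- the prediction from the zero reconstruction is zero
  have hpred (j : ℕ) : ∫ z, (z.1 j - pred a z.2 j) ^ 2 ∂(zeroLaw μ)
      = ∫ z, (z.1 j - z.2 j) ^ 2 ∂(zeroLaw μ) := by
    refine integral_congr_ae ?_
    cases j with
    | zero =>
      filter_upwards [hae 0] with z hz
      rw [hz, pred]
    | succ j =>
      filter_upwards [hae j, hae (j + 1)] with z hz hz'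
      rw [hz', pred, hz, mul_zero]
  have hrec (j : ℕ) : ∫ z, (z.1 j - z.2 j) ^ 2 ∂(zeroLaw μ) = predMSE a v q
      (fun j => ∫ z, (z.1 j - z.2 j) ^ 2 ∂(zeroLaw μ)) j := by
    rw [← hpred]
    exact (isCausal_zeroLaw.integral_sq_predictionError h' (n := j + 1) (fun i _ => hMi i)
      (fun i _ => rfl) j (Nat.lt_succ_self j)).2
  have hle (j : ℕ) : ∫ z, (z.1 j - z.2 j) ^ 2 ∂(zeroLaw μ) ≤ D := by
    induction j with
    | zero => rw [hrec]; exact hq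
    | succ j ih =>
      rw [hrec, predMSE]
      nlinarith [sq_nonneg a]
  have hsymm (z : RSeqPair) : (z.2 k - z.1 k) ^ 2 = (z.1 k - z.2 k) ^ 2 := by ring
  simp only [sampleMSE, hsymm]
  rw [← ofReal_integral_eq_lintegral_ofReal (hMi k) (ae_of_all _ fun z => sq_nonneg _)]
  exact ENNReal.ofReal_le_ofReal (hle k)

end Zero

/-! ### Asymptotics -/

/-- A sequence that retains the fraction `1 - β` of its value at each step and is pushed up by at
least `δ (n + 1) - C` eventually exceeds `δ n` up to a constant. -/
theorem exists_forall_linear_le_of_drift {T : ℕ → ℝ} {β δ C : ℝ} (hβ : 0 < β) (hβ1 : β ≤ 1)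
    (hδ : 0 ≤ δ) {N : ℕ} (h : ∀ n ≥ N, (1 - β) * T n + δ * (n + 1) - C ≤ T (n + 1)) :
    ∃ K, ∀ n ≥ N, δ * n - K ≤ T n := by
  refine ⟨max (C / β) (δ * N - T N), fun n hn => ?_⟩
  set K := max (C / β) (δ * N - T N)
  have hK : C ≤ β * K := by
    have : C / β ≤ K := le_max_left _ _
    rw [div_le_iff₀ hβ] at this
    linarith
  induction n, hn using Nat.le_induction with
  | base =>
    have : δ * N - T N ≤ K := le_max_right _ _
    linarith
  | succ n hn ih =>
    have h1 := h n hn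
    have h2 := mul_le_mul_of_nonneg_left ih (sub_nonneg.2 hβ1)
    have h3 : 0 ≤ (1 - β) * (δ * n) := mul_nonneg (sub_nonneg.2 hβ1) (by positivity)
    push_cast
    nlinarith

theorem avgMSE_le_of_forall_sampleMSE_le {π : Measure RSeqPair} {c : ℝ≥0∞}
    (h : ∀ k, sampleMSE π k ≤ c) : avgMSE π ≤ c := by
  refine limsup_le_of_le (by isBoundedDefault) (Eventually.of_forall fun n => ?_)
  refine ENNReal.div_le_of_le_mul ?_
  calc ∑ k ∈ Finset.range n, sampleMSE π k ≤ ∑ _k ∈ Finset.range n, c :=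
        Finset.sum_le_sum fun k _ => h k
    _ = c * n := by simp [mul_comm]

theorem sampleMSE_ne_top_of_avgMSE_lt_top {π : Measure RSeqPair} (h : avgMSE π < ∞) (k : ℕ) :
    sampleMSE π k ≠ ∞ := by
  obtain ⟨n, hn, hk⟩ := ((eventually_lt_of_limsup_lt h).and (eventually_gt_atTop k)).exists
  have hsum : ∑ k ∈ Finset.range n, sampleMSE π k ≠ ∞ := by
    intro htop
    rw [htop, ENNReal.top_div_of_ne_top (ENNReal.natCast_ne_top n)] at hn
    exact lt_irrefl _ hn
  exact (ENNReal.sum_lt_top.1 hsum.lt_top k (Finset.mem_range.2 hk)).ne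

section Rate

variable {a : ℝ} {v q d : ℝ≥0}

theorem coe_predVar_succ (k : ℕ) : (predVar a v q d (k + 1) : ℝ) = a ^ 2 * d + v := by
  simp [predVar]

/-- The information used by the predictive coding scheme over `n + 1` samples. -/
theorem sum_log_predVar (hd : d ≠ 0) (n : ℕ) :
    ∑ k ∈ Finset.range (n + 1), 1 / 2 * Real.log (predVar a v q d k / d)
      = n * (1 / 2 * Real.log (a ^ 2 + v / d)) + 1 / 2 * Real.log (q / d) := by
  have hd' : (d : ℝ) ≠ 0 := by exact_mod_cast hd
  have h : (a ^ 2 * d + v) / d = a ^ 2 + (v : ℝ) / d := by field_simp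
  rw [Finset.sum_range_succ']
  simp only [coe_predVar_succ, h, Finset.sum_const, Finset.card_range, nsmul_eq_mul]
  rfl

/-- The lower bound for the information in terms of the errors `M k`, split into the information of
the predictive coding scheme and terms that are nonnegative when the errors are at most `d`. -/
theorem sum_lowerBound_eq (hv : v ≠ 0) (hq : q ≠ 0) (hd : d ≠ 0) (M : ℕ → ℝ) (n : ℕ) :
    ∑ k ∈ Finset.range (n + 1), (1 / 2 * Real.log (predVar a v q d k / d)
        + predMSE a v q M k / (2 * predVar a v q d k) - M k / (2 * d))
      = n * (1 / 2 * Real.log (a ^ 2 + v / d)) + 1 / 2 * Real.log (q / d)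
        + (d - M n) / (2 * d)
        + v / (a ^ 2 * d + v) * (∑ k ∈ Finset.range n, (d - M k)) / (2 * d) := by
  have hd' : (d : ℝ) ≠ 0 := by exact_mod_cast hd
  have hq' : (q : ℝ) ≠ 0 := by exact_mod_cast hq
  have hS : a ^ 2 * (d : ℝ) + v ≠ 0 := by
    have : (0 : ℝ) < v := by positivity
    positivity
  simp only [add_sub_assoc, Finset.sum_add_distrib]
  rw [sum_log_predVar hd, add_assoc (_ + _) (_ / _)]
  congr 1
  induction n with
  | zero =>
    simp [predMSE, predVar]
    field_simp
  | succ n ih =>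
    rw [Finset.sum_range_succ, ih, Finset.sum_range_succ, coe_predVar_succ, predMSE]
    field_simp
    ring

end Rate

/-! ### The two rate–distortion functions -/

theorem tendsto_affine_div (r c : ℝ) :
    Tendsto (fun n : ℕ => (n * r + c) / (n + 1)) atTop (𝓝 r) := by
  have h1 : Tendsto (fun n : ℕ => r + (c - r) / ((n : ℝ) + 1)) atTop (𝓝 (r + 0)) :=
    tendsto_const_nhds.add (tendsto_const_nhds.div_atTop
      (tendsto_atTop_add_const_right _ _ tendsto_natCast_atTop_atTop))
  rw [add_zero] at h1
  refine h1.congr fun n => ?_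
  have : (n : ℝ) + 1 ≠ 0 := by positivity
  field_simp
  ring

namespace IsGaussMarkov

variable {μ : Measure RSeq} {a : ℝ} {v q d : ℝ≥0}

theorem causalRDF_eq_zero (h : IsGaussMarkov μ a v q) {D : ℝ} (hq : q ≤ D)
    (hD : a ^ 2 * D + v ≤ D) : causalRDF μ D = 0 := by
  have := h.isProbabilityMeasure
  refine le_antisymm ?_ zero_le
  refine (iInf₂_le (⟨zeroLaw μ, inferInstance⟩ : ProbabilityMeasure RSeqPair)
    ⟨fst_zeroLaw, isCausal_zeroLaw,
      avgMSE_le_of_forall_sampleMSE_le (sampleMSE_zeroLaw_le h hq hD)⟩).trans_eq ?_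
  have : blockInfoRate (zeroLaw μ) = fun _ => 0 := funext blockInfoRate_zeroLaw
  simp [mutualInfoRate, this]

theorem sequentialRDF_eq_zero (h : IsGaussMarkov μ a v q) {D : ℝ} (hq : q ≤ D)
    (hD : a ^ 2 * D + v ≤ D) (n : ℕ) : sequentialRDF μ n D = 0 := by
  have := h.isProbabilityMeasure
  refine le_antisymm ?_ zero_le
  exact (iInf₂_le (⟨zeroLaw μ, inferInstance⟩ : ProbabilityMeasure RSeqPair)
    ⟨fst_zeroLaw, isCausal_zeroLaw, fun k _ => sampleMSE_zeroLaw_le h hq hD k⟩).trans_eq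
    (blockInfoRate_zeroLaw n)

theorem blockInfoRate_codedLaw (h : IsGaussMarkov μ a v q) (hv : v ≠ 0) (hq : q ≠ 0)
    (hd : d ≠ 0) (hlt : ∀ k, d < predVar a v q d k) (n : ℕ) :
    blockInfoRate (codedLaw μ a v q d) (n + 1) = ENNReal.ofReal
      ((n * (1 / 2 * Real.log (a ^ 2 + v / d)) + 1 / 2 * Real.log (q / d)) / (n + 1)) := by
  rw [blockInfoRate, mutualInfo_codedLaw h hv hq hd hlt, sum_log_predVar hd,
    ENNReal.ofReal_div_of_pos (by positivity)]
  congr 1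
  rw [← Nat.cast_succ, ENNReal.ofReal_natCast]

/-- The predictive coding scheme is optimal for the per-sample constraint at every horizon. -/
theorem sequentialRDF_eq (h : IsGaussMarkov μ a v q) (hv : v ≠ 0) (hq : q ≠ 0)
    (hd : d ≠ 0) (hlt : ∀ k, d < predVar a v q d k) (n : ℕ) :
    sequentialRDF μ (n + 1) d = ENNReal.ofReal
      ((n * (1 / 2 * Real.log (a ^ 2 + v / d)) + 1 / 2 * Real.log (q / d)) / (n + 1)) := by
  have := h.isProbabilityMeasure
  refine le_antisymm ?_ (le_iInf₂ ?_)
  · refine (iInf₂_le (⟨codedLaw μ a v q d, inferInstance⟩ : ProbabilityMeasure RSeqPair)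
      ⟨fst_codedLaw, isCausal_codedLaw μ a v q d, fun k _ => ?_⟩).trans_eq
      (blockInfoRate_codedLaw h hv hq hd hlt n)
    rw [ENNReal.ofReal_coe_nnreal]
    exact (sampleMSE_codedLaw h hv hq hd hlt k).le
  · rintro π ⟨hfst, hcausal, hmse⟩
    simp only [ENNReal.ofReal_coe_nnreal] at hmse
    have hfin : ∀ k < n + 1, sampleMSE (π : Measure RSeqPair) k ≠ ∞ := fun k hk =>
      ne_top_of_le_ne_top ENNReal.coe_ne_top (hmse k hk)
    have hM : ∀ k < n + 1, (sampleMSE (π : Measure RSeqPair) k).toReal ≤ d := fun k hk =>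
      ENNReal.toReal_mono ENNReal.coe_ne_top (hmse k hk)
    have hlow := hcausal.ofReal_le_mutualInfo (hfst ▸ h) hv hq hd hfin
    rw [sum_lowerBound_eq hv hq hd] at hlow
    rw [ENNReal.ofReal_div_of_pos (by positivity), blockInfoRate, ← Nat.cast_succ,
      ENNReal.ofReal_natCast]
    refine ENNReal.div_le_div_right ((ENNReal.ofReal_le_ofReal ?_).trans hlow) _
    have h1 : 0 ≤ (d - (sampleMSE (π : Measure RSeqPair) n).toReal) / (2 * d) :=
      div_nonneg (sub_nonneg.2 (hM n (Nat.lt_succ_self n))) (by positivity)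
    have h2 : 0 ≤ v / (a ^ 2 * d + v) * (∑ k ∈ Finset.range n,
        (d - (sampleMSE (π : Measure RSeqPair) k).toReal)) / (2 * d) := by
      have : 0 ≤ ∑ k ∈ Finset.range n, (d - (sampleMSE (π : Measure RSeqPair) k).toReal) :=
        Finset.sum_nonneg fun k hk =>
          sub_nonneg.2 (hM k ((Finset.mem_range.1 hk).trans (Nat.lt_succ_self n)))
      positivity
    linarith

/-- If the information rate stayed below the claimed value, the accumulated excess
`∑ (E[(s_k - y_k)²] - d)` would grow linearly, against the average distortion constraint. -/
theorem le_mutualInfoRate (h : IsGaussMarkov μ a v q) (hv : v ≠ 0) (hq : q ≠ 0) (hd : d ≠ 0)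
    {π : Measure RSeqPair} [IsProbabilityMeasure π] (hfst : π.fst = μ) (hcausal : IsCausal π)
    (hmse : avgMSE π ≤ d) :
    ENNReal.ofReal (1 / 2 * Real.log (a ^ 2 + v / d)) ≤ mutualInfoRate π := by
  set r := 1 / 2 * Real.log (a ^ 2 + v / d) with hr
  by_contra! hlt
  obtain ⟨c, hc1, hc2⟩ := exists_between hlt
  have hctop : c ≠ ∞ := (hc2.trans_le le_top).ne
  set r' := c.toReal with hr'
  have hcr : c = ENNReal.ofReal r' := (ENNReal.ofReal_toReal hctop).symm
  have hrr : r' < r := by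
    rw [hcr] at hc2
    exact (ENNReal.ofReal_lt_ofReal_iff_of_nonneg ENNReal.toReal_nonneg).1 hc2
  have hfin := fun k => sampleMSE_ne_top_of_avgMSE_lt_top (hmse.trans_lt ENNReal.coe_lt_top) k
  set M : ℕ → ℝ := fun k => (sampleMSE π k).toReal with hMdef
  set T : ℕ → ℝ := fun n => ∑ k ∈ Finset.range n, (M k - d) with hT
  have hdpos : (0 : ℝ) < d := by positivity
  have hvpos : (0 : ℝ) < v := by positivity
  set β : ℝ := v / (a ^ 2 * d + v) with hβdef
  have hβ : 0 < β := by positivity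
  have hβ1 : β ≤ 1 := div_le_one_of_le₀ (by nlinarith [mul_nonneg (sq_nonneg a) hdpos.le])
    (by positivity)
  obtain ⟨N, hN⟩ := eventually_atTop.1 (eventually_lt_of_limsup_lt hc1)
  -- a rate below `r'` forces the excess distortion to drift upwards
  have hdrift : ∀ n ≥ N, (1 - β) * T n + 2 * d * (r - r') * (n + 1)
      - 2 * d * (r - 1 / 2 * Real.log (q / d)) ≤ T (n + 1) := by
    intro n hn
    have hlow := hcausal.ofReal_le_mutualInfo (hfst ▸ h) hv hq hd (n := n + 1)
      (fun k _ => hfin k)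
    rw [sum_lowerBound_eq hv hq hd M] at hlow
    have hup := hN (n + 1) (by omega)
    rw [blockInfoRate, ENNReal.div_lt_iff (by simp) (by simp), hcr, ← ENNReal.ofReal_natCast,
      ← ENNReal.ofReal_mul ENNReal.toReal_nonneg] at hup
    have hle := lt_of_not_ge fun hge =>
      (ENNReal.ofReal_le_ofReal hge).not_gt (hlow.trans_lt hup)
    have hneg : ∑ k ∈ Finset.range n, ((d : ℝ) - M k) = -T n := by
      rw [hT, ← Finset.sum_neg_distrib]
      simp
    have hsucc : T (n + 1) = T n + (M n - d) := Finset.sum_range_succ _ _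
    rw [hneg] at hle
    have hmul := mul_lt_mul_of_pos_left hle (by positivity : (0 : ℝ) < 2 * d)
    have e : 2 * d * (n * r + 1 / 2 * Real.log (q / d) + (d - M n) / (2 * d)
        + β * -T n / (2 * d)) = 2 * d * (n * r + 1 / 2 * Real.log (q / d)) + (d - M n)
          - β * T n := by
      field_simp
      ring
    rw [e] at hmul
    push_cast at hmul
    rw [hsucc]
    linarith
  have hδ : 0 < 2 * d * (r - r') := mul_pos (by positivity) (sub_pos.2 hrr)
  obtain ⟨K, hK⟩ := exists_forall_linear_le_of_drift hβ hβ1 hδ.le hdrift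
  set δ := 2 * d * (r - r') with hδdef
  -- compare with the average distortion constraint
  have hlt2 : avgMSE π < ENNReal.ofReal (d + δ / 2) := by
    refine hmse.trans_lt ?_
    rw [← ENNReal.ofReal_coe_nnreal]
    exact (ENNReal.ofReal_lt_ofReal_iff (by positivity)).2 (by linarith)
  obtain ⟨n, ⟨hn, hnN⟩, hnK⟩ := (((eventually_lt_of_limsup_lt hlt2).and
    (eventually_ge_atTop (N + 1))).and (tendsto_natCast_atTop_atTop.eventually_gt_atTop
      (2 * K / δ))).exists
  have hnpos : (0 : ℝ) < n := by exact_mod_cast (by omega : 0 < n)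
  have hsum : ∑ k ∈ Finset.range n, sampleMSE π k = ENNReal.ofReal (T n + n * d) := by
    have : T n + n * d = ∑ k ∈ Finset.range n, M k := by simp [hT]
    rw [this, ENNReal.ofReal_sum_of_nonneg fun _ _ => ENNReal.toReal_nonneg]
    exact Finset.sum_congr rfl fun k _ => (ENNReal.ofReal_toReal (hfin k)).symm
  rw [hsum, ENNReal.div_lt_iff (Or.inl (by simp; omega)) (by simp), ← ENNReal.ofReal_natCast,
    ← ENNReal.ofReal_mul (by positivity),
    ENNReal.ofReal_lt_ofReal_iff (by positivity)] at hn
  have h1 := hK n (by omega)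
  rw [div_lt_iff₀ hδ] at hnK
  nlinarith

theorem causalRDF_eq (h : IsGaussMarkov μ a v q) (hv : v ≠ 0) (hq : q ≠ 0)
    (hd : d ≠ 0) (hlt : ∀ k, d < predVar a v q d k) :
    causalRDF μ d = ENNReal.ofReal (1 / 2 * Real.log (a ^ 2 + v / d)) := by
  have := h.isProbabilityMeasure
  refine le_antisymm ?_ (le_iInf₂ ?_)
  · have hmse : avgMSE (codedLaw μ a v q d) ≤ ENNReal.ofReal d := by
      rw [ENNReal.ofReal_coe_nnreal]
      exact avgMSE_le_of_forall_sampleMSE_le fun k => (sampleMSE_codedLaw h hv hq hd hlt k).le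
    have hrate : mutualInfoRate (codedLaw μ a v q d)
        = ENNReal.ofReal (1 / 2 * Real.log (a ^ 2 + v / d)) := by
      refine Tendsto.limsup_eq ((tendsto_add_atTop_iff_nat 1).1 ?_)
      simp only [blockInfoRate_codedLaw h hv hq hd hlt]
      exact ENNReal.tendsto_ofReal (tendsto_affine_div _ _)
    exact (iInf₂_le (⟨codedLaw μ a v q d, inferInstance⟩ : ProbabilityMeasure RSeqPair)
      ⟨fst_codedLaw, isCausal_codedLaw μ a v q d, hmse⟩).trans_eq hrate
  · rintro π ⟨hfst, hcausal, hmse⟩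
    rw [ENNReal.ofReal_coe_nnreal] at hmse
    exact h.le_mutualInfoRate hv hq hd hfst hcausal hmse

end IsGaussMarkov

theorem mainTheorem2 {Ω : Type*} [MeasurableSpace Ω] (P : Measure Ω) [IsProbabilityMeasure P]
    (a : ℝ) (ha : |a| < 1) (v : ℝ≥0)
    (x ξ : ℕ → Ω → ℝ)
    (hξ_law : ∀ k, HasLaw (ξ k) (gaussianReal 0 v) P)
    (hξ_indep : iIndepFun ξ P)
    (hx_init : HasLaw (x 0) (gaussianReal 0 (Real.toNNReal (v / (1 - a ^ 2)))) P)
    (hx_indep : IndepFun (x 0) (fun ω k => ξ k ω) P)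
    (hx_rec : ∀ k, ∀ᵐ ω ∂P, x (k + 1) ω = a * x k ω + ξ k ω)
    (D : ℝ) (hD : 0 < D) :
    -- the closed form, for all distortions
    causalRDF (P.map fun ω k => x k ω) D
        = ENNReal.ofReal (max 0 (1 / 2 * Real.log (a ^ 2 + v / D))) ∧
    -- up to the source variance the maximum is the logarithm
    (D ≤ v / (1 - a ^ 2) →
      (causalRDF (P.map fun ω k => x k ω) D).toReal = 1 / 2 * Real.log (a ^ 2 + v / D)) ∧
    -- the same value is the limit of the sequential RDF under the per-sample constraint
    Tendsto (fun n : ℕ => sequentialRDF (P.map fun ω k => x k ω) n D) atTop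
      (𝓝 (ENNReal.ofReal (max 0 (1 / 2 * Real.log (a ^ 2 + v / D))))) := by
  have h := isGaussMarkov_map_of_recursion hξ_law hξ_indep hx_init hx_indep hx_rec
  set μ := P.map fun ω k => x k ω
  have ha2 : 0 < 1 - a ^ 2 := by nlinarith [abs_nonneg a, sq_abs a]
  have hq : ((Real.toNNReal (v / (1 - a ^ 2)) : ℝ≥0) : ℝ) = v / (1 - a ^ 2) :=
    Real.coe_toNNReal _ (by positivity)
  set q := Real.toNNReal (v / (1 - a ^ 2))
  have hclosed : causalRDF μ D = ENNReal.ofReal (max 0 (1 / 2 * Real.log (a ^ 2 + v / D))) ∧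
      Tendsto (fun n : ℕ => sequentialRDF μ n D) atTop
        (𝓝 (ENNReal.ofReal (max 0 (1 / 2 * Real.log (a ^ 2 + v / D))))) := by
    rcases le_or_gt (a ^ 2 * D + v) D with hle | hgt
    · -- the source variance is at most `D`: both functions vanish
      have hqD : (q : ℝ) ≤ D := by
        rw [hq, div_le_iff₀ ha2]
        linarith
      have hlog : Real.log (a ^ 2 + v / D) ≤ 0 := by
        refine Real.log_nonpos (by positivity) ?_
        rw [← sub_nonneg]
        have : 1 - (a ^ 2 + v / D) = (D - (a ^ 2 * D + v)) / D := by field_simp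
        rw [this]
        exact div_nonneg (by linarith) hD.le
      rw [max_eq_left (by linarith), ENNReal.ofReal_zero, h.causalRDF_eq_zero hqD hle]
      simp only [h.sequentialRDF_eq_zero hqD hle]
      exact ⟨trivial, tendsto_const_nhds⟩
    · have hv : v ≠ 0 := by
        rintro rfl
        rw [NNReal.coe_zero] at hgt
        nlinarith
      have hvpos : (0 : ℝ) < v := by positivity
      lift D to ℝ≥0 using hD.le
      have hd : D ≠ 0 := by rintro rfl; simp at hD
      have hqD : (D : ℝ) < q := by
        rw [hq, lt_div_iff₀ ha2]
        linarith
      have hq0 : q ≠ 0 := by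
        intro h0
        rw [h0, NNReal.coe_zero] at hqD
        linarith
      have hlt : ∀ k, D < predVar a v q D k := by
        intro k
        rw [← NNReal.coe_lt_coe]
        cases k with
        | zero => exact hqD
        | succ k => rw [coe_predVar_succ]; exact hgt
      have hlog : 0 ≤ Real.log (a ^ 2 + v / D) := by
        refine Real.log_nonneg ?_
        rw [← sub_nonneg]
        have : a ^ 2 + v / D - 1 = ((a ^ 2 * D + v) - D) / (D : ℝ) := by field_simp
        rw [this]
        exact div_nonneg (by linarith) hD.le
      rw [max_eq_right (by linarith)]
      refine ⟨h.causalRDF_eq hv hq0 hd hlt, ?_⟩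
      rw [← tendsto_add_atTop_iff_nat 1]
      simp only [h.sequentialRDF_eq hv hq0 hd hlt]
      exact ENNReal.tendsto_ofReal (tendsto_affine_div _ _)
  refine ⟨hclosed.1, fun hDv => ?_, hclosed.2⟩
  have hlog : 0 ≤ Real.log (a ^ 2 + v / D) := by
    refine Real.log_nonneg ?_
    rw [le_div_iff₀ ha2, mul_comm, ← le_div_iff₀ hD] at hDv
    linarith
  rw [hclosed.1, max_eq_right (by linarith), ENNReal.toReal_ofReal (by linarith)]
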